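/- **Theorem 5 (BFS).** *Setting.* A graph $\mathbb G=(\mathbb V,\mathbb E)$ with $V$ vertices and $E$ edges, directed or undirected, without self-edges and without multiple edges (two opposite directed edges are allowed), is given as a quantum black box, in one of two models. In the *edge list model* the number $|d_i|$ of edges leaving each vertex $v_i$ is known, and the black box, asked $(i,j)$ with $0\le j<|d_i|$, returns the destination of the $j$-th edge leaving $v_i$. In the *adjacency matrix model* the black box, asked $(i,j)$ with $0\le i,j<V$, tells whether there is an edge from $v_i$ to $v_j$. Time is counted on a machine with classical control, quantum subroutines and zero-initialized memory that can be read in superposition: each elementary classical operation, random choice, black-box call, quantum operation on the registers (inverse black-box call, conditional sign flip, reflection about the starting superposition, state preparation, measurement) takes one unit. Here $\lg=\log_2$. *The algorithm.* Let $F$ be a $0/1$-valued function on a domain of size $N$. - **BBHT.** Start with $m=1$. While $m\le 2\sqrt N$: choose a uniformly random integer $0\le j<m$, run Grover's algorithm with $j$ iterations, return the outcome $x$ if $F(x)=1$, and otherwise replace $m$ by $\frac87m$. Return *false* if the loop ends. - **BCWZ** with parameter $w$. Let $T=\min(N,\lceil\lg w\rceil)$ (and $T=0$ if $w\le1$). For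 $t=1,\dots,T$ run the version of Grover's search (with one ancilla bit) that is exact if there are $t$ solutions; then, $3T$ times, run Grover's algorithm with a uniformly random integer $0\le j<\sqrt{N/T}$ of iterations. Return the first outcome $x$ with $F(x)=1$, or *false* if there is none. - **findsol** with parameter $w$. Run BBHT up to two times and then BCWZ with parameter $w$; return the first solution found, or *false*. - **findall** with parameter $w$. Repeatedly run findsol with parameter $w$ on the solutions of $F$ that have not been found yet, until it returns *false*; return the list of all solutions found. - **BFS** from $v_a$ with failure probability $\epsilon$. Start with the queue $(v_a)$ and with only $v_a$ marked. Until the queue is empty: remove its first element $v_i$, visit it, use findall with parameter $V/\epsilon$ (on the edges leaving $v_i$ in the edge list model, on $\mathbb V$ in the matrix model) to find all unmarked neighbours of $v_i$, mark each of them and append it to the queue. *Claim.* Let $0<\epsilon<1$, and let $\epsilon^{-1}$ be polynomially bounded in $V$, i.e. $\epsilon^{-1}\le p(V)$ for a fixed polynomial $p$. For every graph and every source $v_a$, with probability at least $1-\epsilon$ the algorithm BFS executes a breadth-first search from $v_a$: the order in which it visits the vertices is one that classical breadth-first search can produce, each vertex reachable from $v_a$ is visited exactly once and no other vertex is visited,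 and the vertices are visited in order of nondecreasing distance from $v_a$. Its expected running time is $$O\bigl(\sqrt{VE\lg V}\bigr)\quad\text{in the edge list model, for } E\ge1,$$ $$O\bigl(\sqrt{V^3\lg V}\bigr)\quad\text{in the adjacency matrix model, for } V\ge2,$$ where the constants depend only on $p$. -/

import Mathlib

namespace QuantumBFS

open scoped ENNReal

noncomputable section

/-! ### The quantum part of the machine

The quantum registers hold an index `x` into a search domain of size `N`, an answer register `r`
for the black box, and one ancilla bit `b`. -/

/-- Computational basis states `|x, r, b⟩`. -/
abbrev Basis (N : ℕ) (R : Type) : Type := Fin N × R × Bool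

/-- Pure states (not necessarily normalized). -/
abbrev QState (N : ℕ) (R : Type) [Fintype R] : Type := EuclideanSpace ℂ (Basis N R)

variable {N : ℕ} {R : Type} [Fintype R] [DecidableEq R] [AddCommGroup R]

/-- The starting state: the index register in uniform superposition, the answer register in `|0⟩`,
and the ancilla in `√(1-p) |0⟩ + √p |1⟩`. -/
def prep (N : ℕ) (R : Type) [Fintype R] [DecidableEq R] [AddCommGroup R] (p : unitInterval) :
    QState N R :=
  WithLp.toLp 2 fun z =>
    if z.2.1 = 0 then ((Real.sqrt ((if z.2.2 then (p : ℝ) else 1 - p) / N) : ℝ) : ℂ) else 0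

theorem norm_prep (hN : 0 < N) (p : unitInterval) : ‖prep N R p‖ = 1 := by
  have hN' : (N : ℝ) ≠ 0 := by positivity
  have h1 : (0 : ℝ) ≤ p / N := div_nonneg p.2.1 (by positivity)
  have h2 : (0 : ℝ) ≤ (1 - p) / N := div_nonneg (sub_nonneg.2 p.2.2) (by positivity)
  rw [EuclideanSpace.norm_eq, Real.sqrt_eq_one, Fintype.sum_prod_type]
  simp only [Fintype.sum_prod_type, prep]
  have : ∀ r : R, (∑ b : Bool, ‖(if r = 0 then
      ((Real.sqrt ((if b then (p : ℝ) else 1 - p) / N) : ℝ) : ℂ) else 0)‖ ^ 2) =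
      if r = 0 then 1 / (N : ℝ) else 0 := by
    intro r
    split_ifs with h
    · simp only [Fintype.sum_bool, Complex.norm_real, Real.norm_eq_abs, sq_abs, if_true,
        Bool.false_eq_true, if_false]
      rw [Real.sq_sqrt h1, Real.sq_sqrt h2]
      ring
    · simp
  simp only [this]
  simp [hN']

/-- Elementary quantum operations: the black box and its inverse, a sign flip on the basis states
that satisfy a classical predicate (below always a comparison of the answer and a constant number of
lookups, in superposition, in arrays of marks), and the reflection `2|ψ⟩⟨ψ| - 1` about a starting state `ψ`. -/
inductive Gate (N : ℕ) (R : Type) : Type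
  | oracle
  | oracleInv
  | phase (P : Basis N R → Bool)
  | reflect (p : unitInterval)

/-- The black box `|x, r, b⟩ ↦ |x, r + ans x, b⟩` as a permutation of the basis states. -/
def oraclePerm (ans : Fin N → R) : Basis N R ≃ Basis N R where
  toFun z := (z.1, z.2.1 + ans z.1, z.2.2)
  invFun z := (z.1, z.2.1 - ans z.1, z.2.2)
  left_inv z := by simp
  right_inv z := by simp

/-- The unitary operator of a gate. -/
def Gate.op (ans : Fin N → R) : Gate N R → (QState N R ≃ₗᵢ[ℂ] QState N R)
  | .oracle => LinearIsometryEquiv.piLpCongrLeft 2 ℂ ℂ (oraclePerm ans)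
  | .oracleInv => LinearIsometryEquiv.piLpCongrLeft 2 ℂ ℂ (oraclePerm ans).symm
  | .phase P => LinearIsometryEquiv.piLpCongrRight 2 fun z =>
      if P z then LinearIsometryEquiv.neg ℂ else LinearIsometryEquiv.refl ℂ ℂ
  | .reflect p => (Submodule.span ℂ {prep N R p}).reflection

/-- The final state of a circuit: the gates are applied in order, the head of the list first. -/
def runGates (ans : Fin N → R) : List (Gate N R) → QState N R → QState N R
  | [], ψ => ψ
  | g :: c, ψ => runGates ans c (g.op ans ψ)

theorem norm_runGates (ans : Fin N → R) (c : List (Gate N R)) (ψ : QState N R) :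
    ‖runGates ans c ψ‖ = ‖ψ‖ := by
  induction c generalizing ψ with
  | nil => rfl
  | cons g c ih => rw [runGates, ih, LinearIsometryEquiv.norm_map]

/-- Measurement in the computational basis (Born rule). -/
def measure (ψ : QState N R) (h : ‖ψ‖ = 1) : PMF (Basis N R) :=
  PMF.ofFintype (fun z => ENNReal.ofReal (‖ψ z‖ ^ 2)) (by
    rw [← ENNReal.ofReal_sum_of_nonneg (fun _ _ => by positivity), ← EuclideanSpace.norm_sq_eq, h]
    simp)

/-! ### Programs: classical control with quantum subroutines and a time count

The black box answers questions `(i, x)` with `i` a vertex and `x < size i`; the numbers `size i`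
are known, and the answers are accessible only through the instructions below. -/

/-- Programs returning a value of type `α`, as trees of instructions. -/
inductive Prog {V : ℕ} (size : Fin V → ℕ) (R : Type) (α : Type) : Type
  /-- return a value -/
  | ret (a : α) : Prog size R α
  /-- one elementary classical operation (arithmetic, addressing, comparison, memory access) -/
  | tick (k : Prog size R α) : Prog size R α
  /-- one classical call to the black box -/
  | query (i : Fin V) (x : Fin (size i)) (k : R → Prog size R α) : Prog size R α
  /-- a uniformly random integer in `{0, …, n}` -/
  | random (n : ℕ) (k : Fin (n + 1) → Prog size R α) : Prog size R α
  /-- prepare the starting state over the domain of `i`, apply the gates, measure -/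
  | quantum (i : Fin V) (h : 0 < size i) (p : unitInterval) (c : List (Gate (size i) R))
      (k : Basis (size i) R → Prog size R α) : Prog size R α

variable {V : ℕ} {size : Fin V → ℕ} {α β : Type}

/-- Sequential composition. -/
def Prog.bind : Prog size R α → (α → Prog size R β) → Prog size R β
  | .ret a, f => f a
  | .tick k, f => .tick (k.bind f)
  | .query i x k, f => .query i x fun r => (k r).bind f
  | .random n k, f => .random n fun j => (k j).bind f
  | .quantum i h p c k, f => .quantum i h p c fun z => (k z).bind f

instance : Monad (Prog size R) where
  pure := .ret
  bind := Prog.bind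

/-- Spend `t` units of time. -/
def delay (t : ℕ) (D : PMF (α × ℕ)) : PMF (α × ℕ) := D.map fun z => (z.1, z.2 + t)

/-- The joint law of the returned value and the time spent, for a black box with answers `ans`.
Every classical operation, random choice, black-box call, quantum gate, state preparation and
measurement takes one unit of time. -/
def Prog.run (ans : (i : Fin V) → Fin (size i) → R) : Prog size R α → PMF (α × ℕ)
  | .ret a => PMF.pure (a, 0)
  | .tick k => delay 1 (k.run ans)
  | .query i x k => delay 1 ((k (ans i x)).run ans)
  | .random n k => (PMF.uniformOfFintype (Fin (n + 1))).bind fun j => delay 1 ((k j).run ans)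
  | .quantum i h p c k =>
      (measure (runGates (ans i) c (prep (size i) R p))
        ((norm_runGates (ans i) c _).trans (norm_prep h p))).bind
      fun z => delay (c.length + 2) ((k z).run ans)

/-- The expected running time. -/
def Prog.expectedTime (P : Prog size R α) (ans : (i : Fin V) → Fin (size i) → R) : ℝ≥0∞ :=
  ∑' z : α × ℕ, P.run ans z * (z.2 : ℝ≥0∞)

/-- The probability that the returned value violates `S`. -/
def Prog.failureProb (P : Prog size R α) (ans : (i : Fin V) → Fin (size i) → R)
    (S : α → Prop) : ℝ≥0∞ :=
  (P.run ans).toOuterMeasure {z | ¬ S z.1}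

/-- `n` elementary classical operations. -/
def ticks : ℕ → Prog size R Unit
  | 0 => .ret ()
  | n + 1 => .tick (ticks n)

/-- A classical call to the black box. -/
def ask (i : Fin V) (x : Fin (size i)) : Prog size R R := .query i x .ret

/-- A uniformly random integer `j` with `0 ≤ j < m`, for real `m ≥ 1`. -/
def randomBelow (m : ℝ) : Prog size R ℕ := .random (⌈m⌉₊ - 1) fun j => .ret j

/-! ### Search

In this part the function searched is `F x = acc x (ans i x)` on the domain of the vertex `i`. -/

/-- One Grover iteration: call the black box, flip the sign if `F x = 1` (and the ancilla is `1`),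
uncall the black box, reflect about the starting state. -/
def groverIteration (p : unitInterval) (acc : Fin N → R → Bool) : List (Gate N R) :=
  [.oracle, .phase (fun z => acc z.1 z.2.1 && z.2.2), .oracleInv, .reflect p]

/-- `j` Grover iterations, a measurement, and a check of the outcome. With `p = 1` the ancilla is
constantly `1` and this is Grover's original algorithm. -/
def grover (i : Fin V) (acc : Fin (size i) → R → Bool) (p : unitInterval) (j : ℕ) :
    Prog size R (Option (Fin (size i))) :=
  if h : 0 < size i then do
    let z ← Prog.quantum i h p (List.replicate j (groverIteration p acc)).flatten .ret
    let r ← ask i z.1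
    ticks 1
    pure (if acc z.1 r then some z.1 else none)
  else pure none

/-- The loop of BBHT with `λ = 8/7`. The first argument only bounds the number of rounds. -/
def bbhtLoop (i : Fin V) (acc : Fin (size i) → R → Bool) :
    ℕ → ℝ → Prog size R (Option (Fin (size i)))
  | 0, _ => pure none
  | n + 1, m => do
    ticks 1
    if m ≤ 2 * Real.sqrt (size i) then
      let j ← randomBelow m
      match ← grover i acc 1 j with
      | some x => pure (some x)
      | none => bbhtLoop i acc n (8 / 7 * m)
    else pure none

/-- BBHT: search with an unknown number of solutions. The loop ends through its own condition,
as `(8/7)^(14 N + 1) > 2 √N`. -/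
def bbht (i : Fin V) (acc : Fin (size i) → R → Bool) : Prog size R (Option (Fin (size i))) :=
  bbhtLoop i acc (14 * size i + 1) 1

/-- The number of iterations of the exact search for `t` solutions among `N`: the least `j` with
`π / (2 (2 j + 1)) ≤ arcsin √(t / N)`. -/
def exactIter (N t : ℕ) : ℕ := ⌈Real.pi / (4 * Real.arcsin (Real.sqrt (t / N))) - 1 / 2⌉₊

/-- The ancilla weight that makes the search exact: `p · t / N = sin² (π / (2 (2 j + 1)))`. -/
def exactWeight (N t : ℕ) : unitInterval :=
  Set.projIcc 0 1 zero_le_one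
    (Real.sin (Real.pi / (2 * (2 * exactIter N t + 1))) ^ 2 / (t / N))

/-- Exact Grover searches for `t`, `t + 1`, …, `t + n - 1` solutions, until one succeeds. -/
def exactLoop (i : Fin V) (acc : Fin (size i) → R → Bool) :
    ℕ → ℕ → Prog size R (Option (Fin (size i)))
  | 0, _ => pure none
  | n + 1, t => do
    ticks 1
    match ← grover i acc (exactWeight (size i) t) (exactIter (size i) t) with
    | some x => pure (some x)
    | none => exactLoop i acc n (t + 1)

/-- `n` Grover searches with a random number `0 ≤ j < m` of iterations, until one succeeds. -/
def randomLoop (i : Fin V) (acc : Fin (size i) → R → Bool) (m : ℝ) :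
    ℕ → Prog size R (Option (Fin (size i)))
  | 0 => pure none
  | n + 1 => do
    ticks 1
    let j ← randomBelow m
    match ← grover i acc 1 j with
    | some x => pure (some x)
    | none => randomLoop i acc m n

/-- The cut-off of BCWZ for failure probability `1 / w`. -/
def bcwzLevel (N : ℕ) (w : ℝ) : ℕ := min N ⌈Real.logb 2 w⌉₊

/-- BCWZ with parameter `w` (the reciprocal of the failure probability): exact searches for
`1, …, T` solutions, then `3 T` randomized searches fit for more than `T` solutions. -/
def bcwz (i : Fin V) (acc : Fin (size i) → R → Bool) (w : ℝ) :
    Prog size R (Option (Fin (size i))) := do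
  ticks 1
  match ← exactLoop i acc (bcwzLevel (size i) w) 1 with
  | some x => pure (some x)
  | none =>
    let T := bcwzLevel (size i) w
    randomLoop i acc (Real.sqrt (size i / T)) (3 * T)

/-- findsol: BBHT up to two times, then BCWZ. -/
def findsol (i : Fin V) (acc : Fin (size i) → R → Bool) (w : ℝ) :
    Prog size R (Option (Fin (size i))) := do
  match ← bbht i acc with
  | some x => pure (some x)
  | none =>
    match ← bbht i acc with
    | some x => pure (some x)
    | none => bcwz i acc w

/-- The loop of findall. The list `H` holds the results so far; it is kept as a list and as an
array of marks, which is written on insertion and wiped before returning. The first argument only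
bounds the number of rounds. -/
def findallLoop (i : Fin V) (acc : Fin (size i) → R → Bool) (w : ℝ) :
    ℕ → List (Fin (size i)) → Prog size R (List (Fin (size i)))
  | 0, H => pure H
  | n + 1, H => do
    match ← findsol i (fun x r => acc x r && !decide (x ∈ H)) w with
    | some x =>
      ticks 2
      findallLoop i acc w n (H ++ [x])
    | none =>
      ticks (H.length + 1)
      pure H

/-- findall with parameter `w`. There are at most `size i` successful rounds, and a last one. -/
def findall (i : Fin V) (acc : Fin (size i) → R → Bool) (w : ℝ) :
    Prog size R (List (Fin (size i))) :=
  findallLoop i acc w (size i + 1) []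

/-! ### Breadth-first search

`dest i x r` is the neighbour of `i` that the answer `r` to the question `(i, x)` reveals. -/

/-- Ask for the vertices found, mark each as visited and append it to the queue. -/
def enqueueAll (dest : (i : Fin V) → Fin (size i) → R → Option (Fin V)) (i : Fin V) :
    List (Fin (size i)) → List (Fin V) → Finset (Fin V) →
      Prog size R (List (Fin V) × Finset (Fin V))
  | [], q, vis => pure (q, vis)
  | x :: xs, q, vis => do
    let r ← ask i x
    ticks 2
    match dest i x r with
    | some u => enqueueAll dest i xs (q ++ [u]) (insert u vis)
    | none => enqueueAll dest i xs q vis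

/-- The main loop, with queue `q`, the set `vis` of marked vertices (a boolean array) and the list
`out` of the vertices visited so far. The first argument only bounds the number of rounds. -/
def bfsLoop (dest : (i : Fin V) → Fin (size i) → R → Option (Fin V)) (w : ℝ) :
    ℕ → List (Fin V) → Finset (Fin V) → List (Fin V) → Prog size R (List (Fin V))
  | 0, _, _, out => pure out
  | n + 1, q, vis, out => do
    ticks 1
    match q with
    | [] => pure out
    | i :: q =>
      ticks 2
      let xs ← findall i
        (fun x r => match dest i x r with
          | some u => !decide (u ∈ vis)
          | none => false) w
      let s ← enqueueAll dest i xs q vis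
      bfsLoop dest w n s.1 s.2 (out ++ [i])

/-- Breadth-first search from `a` with failure probability `ε`; findall is called with parameter
`V / ε`. At most `V` vertices are ever visited. The memory is initially zero, so that setting up
the queue and the array of marks takes two writes. The result is the list of the vertices in the
order in which they are visited. -/
def bfs (dest : (i : Fin V) → Fin (size i) → R → Option (Fin V)) (a : Fin V) (ε : ℝ) :
    Prog size R (List (Fin V)) := do
  ticks 2
  bfsLoop dest (V / ε) (V + 1) [a] {a} []

end

/-! ### What it means to execute a breadth-first search -/

section Spec

variable {V : ℕ} (G : Digraph (Fin V))

/-- Classical breadth-first search: from the queue and the set of marked vertices (first two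
arguments) the vertices can be visited in the order given by the last argument. -/
inductive ClassicalRun : List (Fin V) → Finset (Fin V) → List (Fin V) → Prop
  | done (vis : Finset (Fin V)) : ClassicalRun [] vis []
  | visit (v : Fin V) (q : List (Fin V)) (vis : Finset (Fin V)) (new l : List (Fin V))
      (nodup : new.Nodup) (mem : ∀ u, u ∈ new ↔ G.Adj v u ∧ u ∉ vis)
      (rest : ClassicalRun (q ++ new) (vis ∪ new.toFinset) l) :
      ClassicalRun (v :: q) vis (v :: l)

/-- There is a directed walk of the given length between the vertices. -/
inductive WalkOfLength : ℕ → Fin V → Fin V → Prop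
  | zero (v : Fin V) : WalkOfLength 0 v v
  | step {n : ℕ} {u v w : Fin V} (h : WalkOfLength n u v) (e : G.Adj v w) :
      WalkOfLength (n + 1) u w

/-- The distance from `u` to `v` (used only where `v` can be reached from `u`). -/
noncomputable def distance (u v : Fin V) : ℕ := sInf {n | WalkOfLength G n u v}

/-- The list `l` is the visiting order of a breadth-first search of `G` from `a`: it arises from
the classical algorithm, it contains each vertex reachable from `a` exactly once and nothing else,
and it is sorted by distance from `a`. -/
structure IsBreadthFirstSearch (a : Fin V) (l : List (Fin V)) : Prop where
  classicalRun : ClassicalRun G [a] {a} l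
  nodup : l.Nodup
  mem_iff : ∀ v, v ∈ l ↔ ∃ n, WalkOfLength G n a v
  sorted : l.Pairwise fun u v => distance G a u ≤ distance G a v

end Spec

/-! ### The two graph models -/

/-- The edge list model: `nbr i j` is the destination of the `j`-th edge that leaves the vertex
`i`, and `deg i` is the number of these edges. No multiple edges, no self-edges. -/
structure EdgeList (V : ℕ) where
  deg : Fin V → ℕ
  nbr : (i : Fin V) → Fin (deg i) → Fin V
  injective : ∀ i, Function.Injective (nbr i)
  loopless : ∀ i j, nbr i j ≠ i

namespace EdgeList

variable {V : ℕ} (G : EdgeList V)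

/-- The underlying graph. -/
def toDigraph : Digraph (Fin V) where
  Adj u v := ∃ j, G.nbr u j = v

/-- `E` is the number of edges of `G`: either `G` is regarded as a directed graph, or `G` is
symmetric and each pair of opposite edges is counted as one undirected edge. -/
def IsEdgeCount (E : ℕ) : Prop :=
  E = ∑ i, G.deg i ∨ ((∀ u v, G.toDigraph.Adj u v → G.toDigraph.Adj v u) ∧ 2 * E = ∑ i, G.deg i)

/-- Breadth-first search in the edge list model: the black box returns the destination `r` of the
edge asked for. The program depends on `G` only through the numbers `G.deg i`. -/
noncomputable def bfs [NeZero V] (deg : Fin V → ℕ) (a : Fin V) (ε : ℝ) :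
    Prog deg (Fin V) (List (Fin V)) :=
  QuantumBFS.bfs (fun _ _ r => some r) a ε

end EdgeList

/-- The adjacency matrix model: a matrix with entries in `{0, 1}`, without self-edges. -/
structure AdjMatrix (V : ℕ) where
  entry : Fin V → Fin V → ZMod 2
  loopless : ∀ i, entry i i = 0

namespace AdjMatrix

variable {V : ℕ} (G : AdjMatrix V)

/-- The underlying graph. -/
def toDigraph : Digraph (Fin V) where
  Adj u v := G.entry u v = 1

/-- Breadth-first search in the adjacency matrix model: the black box is passed two vertices and
tells whether there is an edge from the first to the second. -/
noncomputable def bfs (a : Fin V) (ε : ℝ) :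
    Prog (fun _ : Fin V => V) (ZMod 2) (List (Fin V)) :=
  QuantumBFS.bfs (fun _ x r => if r = 1 then some x else none) a ε

end AdjMatrix

end QuantumBFS

namespace QuantumBFS

open scoped ENNReal

noncomputable section

variable {N : ℕ} {R : Type} [Fintype R] [DecidableEq R] [AddCommGroup R]
variable {V : ℕ} {size : Fin V → ℕ} {α β : Type}

/-! ### Expected costs of programs -/

/-! Both claims are bounds for one functional: `Prog.cost c ans f` is the expectation of `c * time +
f value`. The choice `c = 1`, `f = 0` gives the expected time; `c = 0` with `f` the indicator of
failure gives the failure probability. The functional is real-valued and composes under `bind`.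
`SearchBound` is the contract passed between the search routines. As it holds for every `f`, it can
be applied to the rest of the program, with no independence argument and regardless of which
solution is returned.

Search among `N` items with `t > 0` solutions. Grover's algorithm rotates in a plane, so `j`
iterations fail with probability at most `cos² ((2 j + 1) θ)`; averaged over `j < M` this is at most
`3 / 4` once `2 t M² ≥ N`. Hence BBHT takes time `O(√(N / t))` and fails with probability at most `1
/ (4 t)`, while BCWZ takes `O(1 + √(N T))`, `T ≤ ⌈lg w⌉`, and fails with probability at most `1 /
w`. In findsol, BCWZ is reached with probability at most `1 / (16 t²)`. This is summable over `t`,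
so findall pays for BCWZ only `O(1)` times in expectation and fails with probability at most `1 /
w`. Its BBHT runs cost `O(√(N n))` for `n` solutions found, plus `O(√N)` for the last one
(`cost_findall_le`, `cost_findall_le_of_complete`).

Breadth-first search calls findall at most `V` times, each with failure probability at most `ε / V`.
If all calls are complete, the run is a classical one, and the invariant of classical breadth-first
search gives the rest. The time is governed by the sums of `√(d_i L)` and `√(d_i n_i)` over the
visited vertices, where `L` bounds the levels `T` and the `n_i` add up to less than `V`; a weighted
AM-GM inequality bounds both by `O(√(V S L))`, where `S = ∑ d_i`. -/

theorem tsum_pmf_bind_mul {α β : Type} (D : PMF α) (k : α → PMF β) (g : β → ℝ≥0∞) :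
    ∑' z, (D.bind k) z * g z = ∑' a, D a * ∑' z, k a z * g z := by
  simp only [PMF.bind_apply, ← ENNReal.tsum_mul_right, ← ENNReal.tsum_mul_left]
  rw [ENNReal.tsum_comm]
  simp only [mul_assoc]

theorem tsum_pmf_pure_mul {α : Type} (a : α) (g : α → ℝ≥0∞) :
    ∑' z, (PMF.pure a) z * g z = g a := by
  rw [tsum_eq_single a]
  · simp
  · intro b hb
    simp [PMF.pure_apply, hb]

theorem tsum_delay_mul (t : ℕ) (D : PMF (α × ℕ)) (g : α × ℕ → ℝ≥0∞) :
    ∑' z, (delay t D) z * g z = ∑' z, D z * g (z.1, z.2 + t) := by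
  unfold delay PMF.map
  rw [tsum_pmf_bind_mul]
  simp only [Function.comp_apply, tsum_pmf_pure_mul]

/-- The expectation of `c * time + f value`. -/
def Prog.cost (c : ℝ) (ans : (i : Fin V) → Fin (size i) → R) :
    Prog size R α → (α → ℝ) → ℝ
  | .ret a, f => f a
  | .tick k, f => c + k.cost c ans f
  | .query i x k, f => c + (k (ans i x)).cost c ans f
  | .random n k, f => c + (∑ j, (k j).cost c ans f) / (n + 1)
  | .quantum i _ p g k, f => c * (g.length + 2) +
      ∑ z, ‖runGates (ans i) g (prep (size i) R p) z‖ ^ 2 * (k z).cost c ans f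

/-- Without a charge for time the cost is an average of `f`. After an incomplete findall this bounds
the failure probability of the remaining run by 1. -/
theorem Prog.cost_zero_le (ans : (i : Fin V) → Fin (size i) → R)
    (P : Prog size R α) {f : α → ℝ} {d : ℝ} (h : ∀ a, f a ≤ d) : P.cost 0 ans f ≤ d := by
  induction P with
  | ret a => exact h a
  | tick k ih => simpa [cost] using ih
  | query i x k ih => simpa [cost] using ih _
  | random n k ih =>
    simp only [cost, zero_add]
    rw [div_le_iff₀ (by positivity)]
    refine (Finset.sum_le_sum fun j _ => ih j).trans (le_of_eq ?_)
    simp [mul_comm]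
  | quantum i hN p g k ih =>
    have h1 : ∑ z, ‖runGates (ans i) g (prep (size i) R p) z‖ ^ 2 = 1 := by
      rw [← EuclideanSpace.norm_sq_eq, norm_runGates, norm_prep hN]; norm_num
    simp only [cost, zero_mul, zero_add]
    refine (Finset.sum_le_sum fun z _ =>
      mul_le_mul_of_nonneg_left (ih z) (by positivity)).trans (le_of_eq ?_)
    rw [← Finset.sum_mul, h1, one_mul]

theorem Prog.cost_nonneg {c : ℝ} (hc : 0 ≤ c) (ans : (i : Fin V) → Fin (size i) → R)
    (P : Prog size R α) {f : α → ℝ} (hf : ∀ a, 0 ≤ f a) : 0 ≤ P.cost c ans f := by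
  induction P with
  | ret a => exact hf a
  | tick k ih => exact add_nonneg hc ih
  | query i x k ih => exact add_nonneg hc (ih _)
  | random n k ih =>
    exact add_nonneg hc (div_nonneg (Finset.sum_nonneg fun j _ => ih j) (by positivity))
  | quantum i h p g k ih =>
    exact add_nonneg (by positivity)
      (Finset.sum_nonneg fun z _ => mul_nonneg (by positivity) (ih z))

theorem Prog.cost_bind (c : ℝ) (ans : (i : Fin V) → Fin (size i) → R)
    (P : Prog size R α) (k : α → Prog size R β) (f : β → ℝ) :
    (P.bind k).cost c ans f = P.cost c ans fun a => (k a).cost c ans f := by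
  induction P with
  | ret a => rfl
  | tick k ih => simp only [cost, Prog.bind, ih]
  | query i x k ih => simp only [cost, Prog.bind, ih]
  | random n k ih => simp only [cost, Prog.bind, ih]
  | quantum i h p g k ih => simp only [cost, Prog.bind, ih]

@[simp]
theorem cost_pure (c : ℝ) (ans : (i : Fin V) → Fin (size i) → R) (a : α) (f : α → ℝ) :
    (pure a : Prog size R α).cost c ans f = f a := rfl

@[simp]
theorem cost_monad_bind (c : ℝ) (ans : (i : Fin V) → Fin (size i) → R)
    (P : Prog size R α) (k : α → Prog size R β) (f : β → ℝ) :
    (P >>= k).cost c ans f = P.cost c ans fun a => (k a).cost c ans f :=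
  Prog.cost_bind c ans P k f

@[simp]
theorem cost_ticks (c : ℝ) (ans : (i : Fin V) → Fin (size i) → R) (n : ℕ) (f : Unit → ℝ) :
    (ticks n : Prog size R Unit).cost c ans f = c * n + f () := by
  induction n with
  | zero => simp [ticks, Prog.cost]
  | succ n ih => simp only [ticks, Prog.cost, ih]; push_cast; ring

@[simp]
theorem cost_ask (c : ℝ) (ans : (i : Fin V) → Fin (size i) → R) (i : Fin V)
    (x : Fin (size i)) (f : R → ℝ) :
    (ask i x : Prog size R R).cost c ans f = c + f (ans i x) := rfl

theorem tsum_run_mul {c : ℝ} (hc : 0 ≤ c) (ans : (i : Fin V) → Fin (size i) → R)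
    (P : Prog size R α) {f : α → ℝ} (hf : ∀ a, 0 ≤ f a) :
    ∑' z, P.run ans z * ENNReal.ofReal (c * z.2 + f z.1) = ENNReal.ofReal (P.cost c ans f) := by
  -- The offset `t` is the time already spent; every instruction shifts it by `delay`.
  suffices H : ∀ t : ℕ, ∑' z, P.run ans z * ENNReal.ofReal (c * (z.2 + t : ℕ) + f z.1) =
      ENNReal.ofReal (c * t + P.cost c ans f) by simpa using H 0
  induction P with
  | ret a => intro t; rw [Prog.run, tsum_pmf_pure_mul]; simp [Prog.cost]
  | tick k ih =>
    intro t
    rw [Prog.run, tsum_delay_mul]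
    simp only [Nat.add_assoc]
    rw [ih]
    simp only [Prog.cost]
    push_cast; ring_nf
  | query i x k ih =>
    intro t
    rw [Prog.run, tsum_delay_mul]
    simp only [Nat.add_assoc]
    rw [ih]
    simp only [Prog.cost]
    push_cast; ring_nf
  | random n k ih =>
    intro t
    rw [Prog.run, tsum_pmf_bind_mul]
    simp only [tsum_delay_mul, Nat.add_assoc, ih, PMF.uniformOfFintype_apply, Fintype.card_fin,
      tsum_fintype]
    have hn : ((n + 1 : ℕ) : ℝ≥0∞)⁻¹ = ENNReal.ofReal (1 / ((n : ℝ) + 1)) := by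
      rw [one_div, ENNReal.ofReal_inv_of_pos (by positivity)]
      congr 1
      rw [← ENNReal.ofReal_natCast]; push_cast; rfl
    have h0 : ∀ j, 0 ≤ (k j).cost c ans f := fun j => Prog.cost_nonneg hc ans _ hf
    rw [hn, ← Finset.mul_sum, ← ENNReal.ofReal_sum_of_nonneg, ← ENNReal.ofReal_mul (by positivity)]
    · congr 1
      simp only [Prog.cost, Finset.sum_add_distrib, Finset.sum_const, Finset.card_univ,
        Fintype.card_fin, nsmul_eq_mul]
      push_cast
      field_simp
      ring
    · intro j _
      have := h0 j
      positivity
  | quantum i h p g k ih =>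
    intro t
    rw [Prog.run, tsum_pmf_bind_mul]
    simp only [tsum_delay_mul, Nat.add_assoc, ih, tsum_fintype]
    have h0 : ∀ j, 0 ≤ (k j).cost c ans f := fun j => Prog.cost_nonneg hc ans _ hf
    have h1 : ∑ z, ‖runGates (ans i) g (prep (size i) R p) z‖ ^ 2 = 1 := by
      rw [← EuclideanSpace.norm_sq_eq, norm_runGates, norm_prep h]; norm_num
    simp only [measure, PMF.ofFintype_apply]
    rw [Finset.sum_congr rfl fun z _ => (ENNReal.ofReal_mul (by positivity)).symm,
      ← ENNReal.ofReal_sum_of_nonneg]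
    · congr 1
      simp only [Prog.cost, mul_add, Finset.sum_add_distrib, ← Finset.sum_mul, h1]
      push_cast
      ring
    · intro j _
      have := h0 j
      positivity

theorem expectedTime_eq_cost (ans : (i : Fin V) → Fin (size i) → R) (P : Prog size R α) :
    P.expectedTime ans = ENNReal.ofReal (P.cost 1 ans fun _ => 0) := by
  rw [← tsum_run_mul zero_le_one ans P (fun _ => le_rfl)]
  simp [Prog.expectedTime]

open scoped Classical in
theorem failureProb_eq_cost (ans : (i : Fin V) → Fin (size i) → R) (P : Prog size R α)
    (S : α → Prop) :
    P.failureProb ans S = ENNReal.ofReal (P.cost 0 ans fun a => if S a then 0 else 1) := by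
  rw [← tsum_run_mul le_rfl ans P (fun a => by split_ifs <;> norm_num)]
  rw [Prog.failureProb, PMF.toOuterMeasure_apply]
  refine tsum_congr fun z => ?_
  by_cases h : S z.1 <;> simp [h, Set.indicator]

/-! ### Amplitudes of Grover's algorithm -/

theorem runGates_append (ans : Fin N → R) (c d : List (Gate N R)) (ψ : QState N R) :
    runGates ans (c ++ d) ψ = runGates ans d (runGates ans c ψ) := by
  induction c generalizing ψ with
  | nil => rfl
  | cons g c ih => exact ih _

theorem runGates_replicate_flatten (ans : Fin N → R) (c : List (Gate N R)) (j : ℕ)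
    (ψ : QState N R) :
    runGates ans (List.replicate j c).flatten ψ = (runGates ans c)^[j] ψ := by
  induction j generalizing ψ with
  | zero => rfl
  | succ j ih => rw [List.replicate_succ, List.flatten_cons, runGates_append, ih]; rfl

/-- The basis states on which a Grover iteration flips the sign. -/
def isGood (ans : Fin N → R) (acc : Fin N → R → Bool) (z : Basis N R) : Bool :=
  acc z.1 (ans z.1) && z.2.2

/-- The starting state with its good part scaled by `g` and the rest scaled by `b`. -/
def twoScale (ans : Fin N → R) (acc : Fin N → R → Bool) (p : unitInterval) (g b : ℝ) :
    QState N R :=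
  WithLp.toLp 2 fun z => prep N R p z * ((if isGood ans acc z then g else b : ℝ) : ℂ)

/-- The probability of the good part of the starting state. -/
def goodWeight (ans : Fin N → R) (acc : Fin N → R → Bool) (p : unitInterval) : ℝ :=
  ∑ z : Basis N R, if isGood ans acc z then ‖prep N R p z‖ ^ 2 else 0

theorem goodWeight_eq (ans : Fin N → R) (acc : Fin N → R → Bool) (p : unitInterval) :
    goodWeight ans acc p =
      p * (Finset.univ.filter fun x => acc x (ans x) = true).card / N := by
  have h1 : (0 : ℝ) ≤ p / N := div_nonneg p.2.1 (by positivity)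
  unfold goodWeight
  simp only [Fintype.sum_prod_type, isGood, prep]
  have : ∀ (x : Fin N) (r : R), (∑ b : Bool, if (acc x (ans x) && b) = true then
      ‖(if r = 0 then ((Real.sqrt ((if b then (p : ℝ) else 1 - p) / N) : ℝ) : ℂ) else 0)‖ ^ 2
        else 0) = if r = 0 then (if acc x (ans x) then (p : ℝ) / N else 0) else 0 := by
    intro x r
    by_cases hr : r = 0
    · by_cases hx : acc x (ans x) = true
      · simp only [hr, hx, Fintype.sum_bool, if_true, Complex.norm_real, Real.norm_eq_abs,
          sq_abs, Real.sq_sqrt h1]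
        simp
      · simp [hx]
    · simp [hr]
  simp only [this]
  have h2 : ∀ x : Fin N, (∑ r : R, if r = 0 then (if acc x (ans x) then (p : ℝ) / N else 0)
      else 0) = if acc x (ans x) then (p : ℝ) / N else 0 := fun x => by
    rw [Finset.sum_ite_eq', if_pos (Finset.mem_univ _)]
  rw [Finset.sum_congr rfl fun x _ => h2 x, ← Finset.sum_filter, Finset.sum_const, nsmul_eq_mul]
  ring

theorem inner_prep_twoScale (hN : 0 < N) (ans : Fin N → R) (acc : Fin N → R → Bool)
    (p : unitInterval) (g b : ℝ) :
    inner ℂ (prep N R p) (twoScale ans acc p g b) =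
      ((goodWeight ans acc p * g + (1 - goodWeight ans acc p) * b : ℝ) : ℂ) := by
  have h1 : ∑ z : Basis N R, ‖prep N R p z‖ ^ 2 = 1 := by
    rw [← EuclideanSpace.norm_sq_eq, norm_prep hN]; norm_num
  have h2 : goodWeight ans acc p * g + (1 - goodWeight ans acc p) * b =
      ∑ z : Basis N R, ‖prep N R p z‖ ^ 2 * (if isGood ans acc z then g else b) := by
    rw [← h1, goodWeight, ← Finset.sum_sub_distrib, Finset.sum_mul, Finset.sum_mul,
      ← Finset.sum_add_distrib]
    refine Finset.sum_congr rfl fun z _ => ?_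
    split_ifs <;> ring
  rw [h2, PiLp.inner_apply, Complex.ofReal_sum]
  refine Finset.sum_congr rfl fun z _ => ?_
  simp only [twoScale, RCLike.inner_apply]
  rw [mul_right_comm, Complex.mul_conj, Complex.normSq_eq_norm_sq]
  push_cast
  rfl

/-- The states `twoScale` form a plane that is invariant under a Grover iteration: the first three
gates negate `g`, and the reflection needs only the inner product with the starting state. -/
theorem runGates_groverIteration (hN : 0 < N) (ans : Fin N → R) (acc : Fin N → R → Bool)
    (p : unitInterval) (g b : ℝ) :
    runGates ans (groverIteration p acc) (twoScale ans acc p g b) =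
      twoScale ans acc p
        (2 * (-(goodWeight ans acc p * g) + (1 - goodWeight ans acc p) * b) + g)
        (2 * (-(goodWeight ans acc p * g) + (1 - goodWeight ans acc p) * b) - b) := by
  have key : runGates ans [Gate.oracle, .phase (fun z => acc z.1 z.2.1 && z.2.2), .oracleInv]
      (twoScale ans acc p g b) = twoScale ans acc p (-g) b := by
    ext z
    have : runGates ans [Gate.oracle, .phase (fun z => acc z.1 z.2.1 && z.2.2), .oracleInv]
        (twoScale ans acc p g b) z =
        (if (acc z.1 (z.2.1 + ans z.1) && z.2.2) = true then
          LinearIsometryEquiv.neg ℂ else LinearIsometryEquiv.refl ℂ ℂ :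
            ℂ ≃ₗᵢ[ℂ] ℂ) (twoScale ans acc p g b
              ((oraclePerm ans).symm (oraclePerm ans z))) := rfl
    rw [this, Equiv.symm_apply_apply]
    -- The state is supported on answer register 0, where the black box writes exactly `ans z.1`;
    -- elsewhere both sides vanish.
    by_cases hr : z.2.1 = 0
    · have hP : (acc z.1 (z.2.1 + ans z.1) && z.2.2) = isGood ans acc z := by
        rw [hr, zero_add]; rfl
      rw [hP]
      by_cases hz : isGood ans acc z = true <;> simp [twoScale, hz]
    · have h0 : prep N R p z = 0 := by simp [prep, hr]
      simp [twoScale, h0]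
  have h2 : groverIteration p acc =
      [Gate.oracle, .phase (fun z => acc z.1 z.2.1 && z.2.2), .oracleInv] ++ [.reflect p] := rfl
  rw [h2, runGates_append, key]
  change (Submodule.span ℂ {prep N R p}).reflection _ = _
  rw [Submodule.reflection_singleton_apply, inner_prep_twoScale hN, norm_prep hN]
  ext z
  simp only [twoScale, PiLp.sub_apply, PiLp.smul_apply, smul_eq_mul, nsmul_eq_mul]
  split_ifs <;> push_cast <;> simp <;> ring

/-- Each iteration adds `2 θ` to the angle. The relations are multiplied out because `sin θ` or `cos
θ` may be zero. -/
theorem exists_iterate_groverIteration (hN : 0 < N) (ans : Fin N → R) (acc : Fin N → R → Bool)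
    (p : unitInterval) {θ : ℝ} (hθ : Real.sin θ ^ 2 = goodWeight ans acc p) (j : ℕ) :
    ∃ g b : ℝ, (runGates ans (groverIteration p acc))^[j] (prep N R p) = twoScale ans acc p g b ∧
      Real.sin θ * g = Real.sin ((2 * j + 1) * θ) ∧
      Real.cos θ * b = Real.cos ((2 * j + 1) * θ) := by
  induction j with
  | zero => exact ⟨1, 1, by ext z; simp [twoScale], by simp, by simp⟩
  | succ j ih =>
    obtain ⟨g, b, h, hg, hb⟩ := ih
    refine ⟨_, _, by rw [Function.iterate_succ_apply', h, runGates_groverIteration hN], ?_, ?_⟩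
    · have e : (2 * ((j + 1 : ℕ) : ℝ) + 1) * θ = (2 * j + 1) * θ + 2 * θ := by push_cast; ring
      rw [e, Real.sin_add, ← hg, ← hb, Real.sin_two_mul, Real.cos_two_mul, ← hθ,
        ← Real.cos_sq']
      linear_combination 2 * Real.sin θ * g * (Real.sin_sq_add_cos_sq θ).symm
    · have e : (2 * ((j + 1 : ℕ) : ℝ) + 1) * θ = (2 * j + 1) * θ + 2 * θ := by push_cast; ring
      rw [e, Real.cos_add, ← hg, ← hb, Real.sin_two_mul, Real.cos_two_mul, ← hθ,
        ← Real.cos_sq']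
      ring

/-- Lower bound for the probability that Grover's algorithm ends in a solution. -/
theorem sin_sq_le_sum_norm_sq (hN : 0 < N) (ans : Fin N → R) (acc : Fin N → R → Bool)
    (p : unitInterval) {θ : ℝ} (hθ : Real.sin θ ^ 2 = goodWeight ans acc p) (j : ℕ) :
    Real.sin ((2 * j + 1) * θ) ^ 2 ≤ ∑ z : Basis N R, if acc z.1 (ans z.1) then
      ‖runGates ans (List.replicate j (groverIteration p acc)).flatten (prep N R p) z‖ ^ 2
        else 0 := by
  obtain ⟨g, b, h, hg, -⟩ := exists_iterate_groverIteration hN ans acc p hθ j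
  rw [runGates_replicate_flatten, h, ← hg, mul_pow, hθ, goodWeight, Finset.sum_mul]
  refine Finset.sum_le_sum fun z _ => ?_
  by_cases hz : isGood ans acc z = true
  · have hz' : acc z.1 (ans z.1) = true := by
      simp only [isGood, Bool.and_eq_true] at hz; exact hz.1
    simp [hz, hz', twoScale, mul_pow]
  -- A solution measured with ancilla 0 is a success too; dropping these states makes the result an
  -- inequality.
  · rw [if_neg hz, zero_mul]
    split_ifs <;> positivity

/-! ### Averages over the number of iterations -/

/-- The sum telescopes: `2 sin 2θ cos ((4j+2) θ) = sin (4(j+1)θ) - sin (4jθ)`. -/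
theorem sum_cos_sq_mul (θ : ℝ) (M : ℕ) :
    4 * Real.sin (2 * θ) * ∑ j ∈ Finset.range M, Real.cos ((2 * j + 1) * θ) ^ 2 =
      2 * M * Real.sin (2 * θ) + Real.sin (4 * M * θ) := by
  induction M with
  | zero => simp
  | succ M ih =>
    rw [Finset.sum_range_succ, mul_add, ih, Real.cos_sq]
    have e1 : (4 * ((M + 1 : ℕ) : ℝ)) * θ = 2 * ((2 * M + 1) * θ) + 2 * θ := by push_cast; ring
    have e2 : (4 * (M : ℝ)) * θ = 2 * ((2 * M + 1) * θ) - 2 * θ := by ring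
    rw [e1, e2, Real.sin_add, Real.sin_sub]
    push_cast
    ring

theorem sum_cos_sq_le_of_small {θ : ℝ} (h0 : 0 < θ) (h1 : θ < Real.pi / 2) {M : ℕ}
    (hM : 1 ≤ M * Real.sin (2 * θ)) :
    ∑ j ∈ Finset.range M, Real.cos ((2 * j + 1) * θ) ^ 2 ≤ 3 / 4 * M := by
  have hs : 0 < Real.sin (2 * θ) := Real.sin_pos_of_pos_of_lt_pi (by linarith) (by linarith)
  have h := sum_cos_sq_mul θ M
  have h2 := Real.sin_le_one (4 * M * θ)
  refine le_of_mul_le_mul_left ?_ (mul_pos four_pos hs)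
  rw [h]
  linarith

/-- No lower bound on `M` is needed here. With `φ = π / 2 - θ` the oscillating term is `-sin (4Mφ)`,
which is not positive up to `4Mφ = π`; beyond that, Jordan's inequality gives `M sin 2φ ≥ 1`. The
case `θ = π / 2` is separate because `sin 2θ` vanishes. -/
theorem sum_cos_sq_le_of_large {θ : ℝ} (h0 : Real.pi / 4 ≤ θ) (h1 : θ ≤ Real.pi / 2) (M : ℕ) :
    ∑ j ∈ Finset.range M, Real.cos ((2 * j + 1) * θ) ^ 2 ≤ 3 / 4 * M := by
  obtain rfl | h1 := eq_or_lt_of_le h1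
  · have : ∀ j ∈ Finset.range M, Real.cos ((2 * j + 1) * (Real.pi / 2)) ^ 2 = 0 := by
      intro j _
      have : Real.cos ((2 * j + 1) * (Real.pi / 2)) = 0 :=
        Real.cos_eq_zero_iff.2 ⟨j, by push_cast; ring⟩
      rw [this]; norm_num
    rw [Finset.sum_eq_zero this]
    positivity
  · have hs : 0 < Real.sin (2 * θ) := by
      apply Real.sin_pos_of_pos_of_lt_pi <;> linarith [Real.pi_pos]
    have h := sum_cos_sq_mul θ M
    set φ := Real.pi / 2 - θ with hφ
    have e1 : Real.sin (2 * θ) = Real.sin (2 * φ) := by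
      rw [← Real.sin_pi_sub]; congr 1; rw [hφ]; ring
    have e2 : Real.sin (4 * M * θ) = -Real.sin (4 * M * φ) := by
      have : 4 * M * θ = (M : ℝ) * (2 * Real.pi) - 4 * M * φ := by rw [hφ]; ring
      rw [this, Real.sin_nat_mul_two_pi_sub]
    have hφ0 : 0 < φ := by rw [hφ]; linarith
    have hj : 2 / Real.pi * (2 * φ) ≤ Real.sin (2 * φ) :=
      Real.mul_le_sin (by linarith) (by rw [hφ]; linarith)
    have key : -Real.sin (4 * M * φ) ≤ M * Real.sin (2 * φ) := by
      rcases le_total (4 * M * φ) Real.pi with h3 | h3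
      · have := Real.sin_nonneg_of_nonneg_of_le_pi (x := 4 * M * φ) (by positivity) h3
        have h5 : 0 ≤ M * Real.sin (2 * φ) := by rw [← e1]; positivity
        linarith
      · have h5 : (M : ℝ) * (2 / Real.pi * (2 * φ)) ≤ M * Real.sin (2 * φ) := by gcongr
        have h6 : 1 ≤ (M : ℝ) * (2 / Real.pi * (2 * φ)) := by
          have : (M : ℝ) * (2 / Real.pi * (2 * φ)) = 4 * M * φ / Real.pi := by ring
          rw [this, le_div_iff₀ Real.pi_pos]; linarith
        linarith [Real.neg_one_le_sin (4 * M * φ)]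
    refine le_of_mul_le_mul_left ?_ (mul_pos four_pos hs)
    rw [h, e2, e1]
    linarith

/-- Enough iterations, chosen at random, find a solution with probability at least `1 / 4`. -/
theorem sum_cos_sq_le {s : ℝ} (hs0 : 0 < s) (hs1 : s ≤ 1) {M : ℕ} (hM : 1 ≤ 2 * s * M ^ 2) :
    ∑ j ∈ Finset.range M, Real.cos ((2 * j + 1) * Real.arcsin (Real.sqrt s)) ^ 2 ≤ 3 / 4 * M := by
  have hq0 : 0 < Real.sqrt s := Real.sqrt_pos.2 hs0
  have hq1 : Real.sqrt s ≤ 1 := Real.sqrt_le_one.2 hs1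
  rcases lt_or_ge (Real.arcsin (Real.sqrt s)) (Real.pi / 4) with h | h
  · refine sum_cos_sq_le_of_small (Real.arcsin_pos.2 hq0) (by linarith [Real.pi_pos]) ?_
    rw [Real.sin_two_mul, Real.sin_arcsin (by linarith) hq1, Real.cos_arcsin, Real.sq_sqrt hs0.le]
    have hs2 : s ≤ 1 / 2 := by
      rw [Real.arcsin_lt_iff_lt_sin' ⟨by linarith [Real.pi_pos], by linarith [Real.pi_pos]⟩,
        Real.sin_pi_div_four] at h
      calc s = Real.sqrt s ^ 2 := (Real.sq_sqrt hs0.le).symm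
        _ ≤ (Real.sqrt 2 / 2) ^ 2 := by gcongr
        _ = 1 / 2 := by rw [div_pow, Real.sq_sqrt (by norm_num)]; norm_num
    have : 0 ≤ (M : ℝ) * (2 * Real.sqrt s * Real.sqrt (1 - s)) := by positivity
    -- `(M sin 2θ)² = 4 s (1 - s) M² ≥ 2 s M²`, as `s ≤ 1 / 2`.
    refine (one_le_sq_iff₀ this).1 ?_
    rw [mul_pow, mul_pow, mul_pow, Real.sq_sqrt hs0.le, Real.sq_sqrt (by linarith)]
    have : 0 ≤ s * (M : ℝ) ^ 2 := by positivity
    nlinarith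
  · exact sum_cos_sq_le_of_large h (Real.arcsin_le_pi_div_two _) M

/-! ### Search programs -/

/-- The program `S` returns solutions only, its expected time is at most `τ`, and it returns `none`
with probability at most `q`. -/
def SearchBound {γ : Type} (ans : (i : Fin V) → Fin (size i) → R) (S : Prog size R (Option γ))
    (sol : γ → Prop) (τ q : ℝ) : Prop :=
  ∀ (c A B : ℝ) (f : Option γ → ℝ), 0 ≤ c → 0 ≤ B → (∀ x, sol x → f (some x) ≤ A) →
    f none ≤ A + B → S.cost c ans f ≤ c * τ + A + q * B

namespace SearchBound

variable {γ : Type} {ans : (i : Fin V) → Fin (size i) → R} {S : Prog size R (Option γ)}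
  {sol : γ → Prop} {τ q : ℝ}

theorem mono (h : SearchBound ans S sol τ q) {τ' q' : ℝ} (hτ : τ ≤ τ') (hq : q ≤ q') :
    SearchBound ans S sol τ' q' := by
  intro c A B f hc hB h1 h2
  refine (h c A B f hc hB h1 h2).trans ?_
  gcongr

theorem none : SearchBound ans (pure Option.none) sol 0 1 := by
  intro c A B f hc hB h1 h2
  simpa using h2

theorem ticks_bind (h : SearchBound ans S sol τ q) (n : ℕ) {k : Unit → Prog size R (Option γ)}
    (hk : k () = S) : SearchBound ans (ticks n >>= k) sol (n + τ) q := by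
  intro c A B f hc hB h1 h2
  have := h c A B f hc hB h1 h2
  simp only [cost_monad_bind, cost_ticks, hk]
  linarith

/-- The fallback plays the role of the penalty: the bound for `S` is used with `c * τ' + q' * B` in
place of `B`. -/
theorem orElse {S' : Prog size R (Option γ)} {τ' q' : ℝ} (h : SearchBound ans S sol τ q)
    (h' : SearchBound ans S' sol τ' q') (hτ' : 0 ≤ τ') (hq' : 0 ≤ q')
    {k : Option γ → Prog size R (Option γ)} (hs : ∀ x, k (some x) = pure (some x))
    (hn : k Option.none = S') :
    SearchBound ans (S >>= k) sol (τ + q * τ') (q * q') := by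
  intro c A B f hc hB h1 h2
  rw [cost_monad_bind]
  have := h c A (c * τ' + q' * B) (fun a => (k a).cost c ans f) hc (by positivity)
    (fun x hx => by simpa [hs] using h1 x hx)
    (by simp only [hn]; linarith [h' c A B f hc hB h1 h2])
  linarith

/-- Regroups a random choice and the Grover run after it into one search, to which `orElse` applies.
-/
theorem bind_assoc {δ : Type} {P : Prog size R δ} {S : δ → Prog size R (Option γ)}
    {k : Option γ → Prog size R (Option γ)} (h : SearchBound ans ((P >>= S) >>= k) sol τ q) :
    SearchBound ans (P >>= fun j => S j >>= k) sol τ q := by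
  intro c A B f hc hB h1 h2
  simpa only [cost_monad_bind] using h c A B f hc hB h1 h2

theorem randomBelow_bind {S : ℕ → Prog size R (Option γ)} {τ q : ℕ → ℝ} {m : ℝ} (hm : 0 < m)
    (h : ∀ j, SearchBound ans (S j) sol (τ j) (q j)) :
    SearchBound ans (randomBelow m >>= S) sol
      (1 + (∑ j ∈ Finset.range ⌈m⌉₊, τ j) / ⌈m⌉₊) ((∑ j ∈ Finset.range ⌈m⌉₊, q j) / ⌈m⌉₊) := by
  intro c A B f hc hB h1 h2
  obtain ⟨M, hM⟩ : ∃ M, ⌈m⌉₊ = M + 1 := Nat.exists_eq_add_one.2 (Nat.ceil_pos.2 hm)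
  rw [cost_monad_bind, randomBelow, show ⌈m⌉₊ - 1 = M by omega]
  simp only [hM, Prog.cost]
  have h3 : ∑ j : Fin (M + 1), (S j).cost c ans f ≤
      ∑ j : Fin (M + 1), (c * τ j + A + q j * B) :=
    Finset.sum_le_sum fun j _ => h j c A B f hc hB h1 h2
  have h4 : ∑ j : Fin (M + 1), (c * τ j + A + q j * B) =
      c * ∑ j ∈ Finset.range (M + 1), τ j + (M + 1) * A +
        (∑ j ∈ Finset.range (M + 1), q j) * B := by
    rw [Fin.sum_univ_eq_sum_range (fun j => c * τ j + A + q j * B) (M + 1)]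
    simp only [Finset.sum_add_distrib, ← Finset.mul_sum, ← Finset.sum_mul, Finset.sum_const,
      Finset.card_range, nsmul_eq_mul]
    push_cast
    ring
  rw [h4] at h3
  have h5 := div_le_div_of_nonneg_right h3 (by positivity : (0 : ℝ) ≤ (M : ℝ) + 1)
  push_cast
  refine (add_le_add_right h5 c).trans (le_of_eq ?_)
  field_simp
  ring

end SearchBound

/-- The number of solutions. -/
def solCount {R : Type} (ans : Fin N → R) (acc : Fin N → R → Bool) : ℕ :=
  (Finset.univ.filter fun x => acc x (ans x) = true).card

theorem solCount_le {R : Type} (ans : Fin N → R) (acc : Fin N → R → Bool) : solCount ans acc ≤ N := by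
  simpa [solCount] using Finset.card_filter_le Finset.univ fun x => acc x (ans x) = true

/-- Solutions of a search problem on the domain of `i`. -/
abbrev IsSol (ans : (i : Fin V) → Fin (size i) → R) (i : Fin V)
    (acc : Fin (size i) → R → Bool) (x : Fin (size i)) : Prop :=
  acc x (ans i x) = true

section Subroutines

variable (ans : (i : Fin V) → Fin (size i) → R) (i : Fin V) (acc : Fin (size i) → R → Bool)

/-- The time is `4 j` gates, preparation and measurement, one query and one comparison. -/
theorem searchBound_grover {p : unitInterval} {θ : ℝ}
    (hθ : Real.sin θ ^ 2 = goodWeight (ans i) acc p) (h : 0 < size i) (j : ℕ) :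
    SearchBound ans (grover i acc p j) (IsSol ans i acc) (4 * j + 4)
      (Real.cos ((2 * j + 1) * θ) ^ 2) := by
  intro c A B f hc hB h1 h2
  rw [grover, dif_pos h]
  simp only [cost_monad_bind, Prog.cost, cost_ask, cost_ticks, cost_pure]
  set P : Basis (size i) R → ℝ := fun z => ‖runGates (ans i)
    (List.replicate j (groverIteration p acc)).flatten (prep (size i) R p) z‖ ^ 2 with hP
  have hP1 : ∑ z, P z = 1 := by
    rw [hP, ← EuclideanSpace.norm_sq_eq, norm_runGates, norm_prep h]; norm_num
  have hgood : Real.sin ((2 * j + 1) * θ) ^ 2 ≤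
      ∑ z : Basis (size i) R, if acc z.1 (ans i z.1) then P z else 0 :=
    sin_sq_le_sum_norm_sq h (ans i) acc p hθ j
  have hlen : (List.replicate j (groverIteration p acc)).flatten.length = 4 * j := by
    simp [groverIteration, mul_comm]
  rw [hlen]
  have key : ∑ z, P z * (c + (c * (1 : ℕ) + f (if acc z.1 (ans i z.1) then some z.1 else none))) ≤
      ∑ z, (P z * (2 * c + A + B) - (if acc z.1 (ans i z.1) then P z else 0) * B) := by
    refine Finset.sum_le_sum fun z _ => ?_
    have hz : 0 ≤ P z := by positivity
    by_cases hs : acc z.1 (ans i z.1) = true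
    · rw [if_pos hs, if_pos hs]
      have := mul_le_mul_of_nonneg_left (h1 z.1 hs) hz
      push_cast
      linarith
    · rw [if_neg hs, if_neg hs]
      have := mul_le_mul_of_nonneg_left h2 hz
      push_cast
      linarith
  rw [Finset.sum_sub_distrib, ← Finset.sum_mul, ← Finset.sum_mul, hP1] at key
  refine (add_le_add_right key _).trans ?_
  have := mul_le_mul_of_nonneg_right hgood hB
  rw [Real.cos_sq']
  push_cast
  linarith

theorem searchBound_grover_one (j : ℕ) :
    SearchBound ans (grover i acc 1 j) (IsSol ans i acc) (4 * j + 4)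
      (Real.cos ((2 * j + 1) *
        Real.arcsin (Real.sqrt (solCount (ans i) acc / size i))) ^ 2) := by
  rcases Nat.eq_zero_or_pos (size i) with h | h
  · rw [grover, dif_neg (by omega)]
    refine SearchBound.none.mono (by positivity) ?_
    -- On an empty domain the quotient is 0 by convention, so the angle is 0 and the failure bound
    -- is 1.
    simp [h]
  · refine searchBound_grover ans i acc ?_ h j
    have h1 : (solCount (ans i) acc : ℝ) ≤ size i := by exact_mod_cast solCount_le (ans i) acc
    have h0 : (0 : ℝ) ≤ solCount (ans i) acc / size i := by positivity
    have h2 : (solCount (ans i) acc : ℝ) / size i ≤ 1 := div_le_one_of_le₀ h1 (by positivity)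
    rw [Real.sin_arcsin (by linarith [Real.sqrt_nonneg ((solCount (ans i) acc : ℝ) / size i)])
      (Real.sqrt_le_one.2 h2), Real.sq_sqrt h0, goodWeight_eq]
    simp [solCount]

theorem searchBound_grover_le_one (p : unitInterval) (j : ℕ) :
    SearchBound ans (grover i acc p j) (IsSol ans i acc) (4 * j + 4) 1 := by
  rcases Nat.eq_zero_or_pos (size i) with h | h
  · rw [grover, dif_neg (by omega)]
    exact SearchBound.none.mono (by positivity) le_rfl
  · have h1 : (solCount (ans i) acc : ℝ) ≤ size i := by exact_mod_cast solCount_le (ans i) acc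
    have h0 : (0 : ℝ) ≤ goodWeight (ans i) acc p :=
      Finset.sum_nonneg fun z _ => by split_ifs <;> positivity
    have h2 : goodWeight (ans i) acc p ≤ 1 := by
      rw [goodWeight_eq, div_le_one (by exact_mod_cast h)]
      calc (p : ℝ) * _ ≤ 1 * solCount (ans i) acc :=
            mul_le_mul_of_nonneg_right p.2.2 (by positivity)
        _ ≤ size i := by linarith
    refine (searchBound_grover ans i acc (θ := Real.arcsin (Real.sqrt (goodWeight (ans i) acc p)))
      ?_ h j).mono le_rfl (Real.cos_sq_le_one _)
    rw [Real.sin_arcsin (by linarith [Real.sqrt_nonneg (goodWeight (ans i) acc p)])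
      (Real.sqrt_le_one.2 h2), Real.sq_sqrt h0]

theorem sum_range_four_mul_add_four (M : ℕ) :
    ∑ j ∈ Finset.range M, (4 * (j : ℝ) + 4) = 2 * M * (M + 1) := by
  induction M with
  | zero => simp
  | succ M ih => rw [Finset.sum_range_succ, ih]; push_cast; ring

/-- The left side is `1 + 2 (⌈m⌉ + 1) ≤ 2 m + 5`. -/
theorem one_add_avg_time_le {m : ℝ} (hm : 1 ≤ m) :
    1 + (∑ j ∈ Finset.range ⌈m⌉₊, (4 * (j : ℝ) + 4)) / ⌈m⌉₊ ≤ 7 * m := by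
  have h0 : (0 : ℝ) < ⌈m⌉₊ := by exact_mod_cast Nat.ceil_pos.2 (by linarith)
  rw [sum_range_four_mul_add_four]
  have h1 := Nat.ceil_lt_add_one (by linarith : 0 ≤ m)
  have h2 : 2 * (⌈m⌉₊ : ℝ) * (⌈m⌉₊ + 1) / ⌈m⌉₊ = 2 * (⌈m⌉₊ + 1) := by field_simp
  rw [h2]
  linarith

theorem searchBound_random_grover {m : ℝ} (hm : 1 ≤ m) :
    SearchBound ans (randomBelow m >>= fun j => grover i acc 1 j) (IsSol ans i acc) (7 * m) 1 := by
  refine (SearchBound.randomBelow_bind (by linarith) fun j =>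
    searchBound_grover_le_one ans i acc 1 j).mono (one_add_avg_time_le hm) ?_
  have h0 : (0 : ℝ) < ⌈m⌉₊ := by exact_mod_cast Nat.ceil_pos.2 (by linarith)
  simp [h0.ne']

theorem searchBound_random_grover_of_le {m : ℝ} (hm : 1 ≤ m) (ht : 0 < solCount (ans i) acc)
    (hN : size i ≤ 2 * solCount (ans i) acc * m ^ 2) :
    SearchBound ans (randomBelow m >>= fun j => grover i acc 1 j) (IsSol ans i acc)
      (7 * m) (3 / 4) := by
  refine (SearchBound.randomBelow_bind (by linarith) fun j =>
    searchBound_grover_one ans i acc j).mono (one_add_avg_time_le hm) ?_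
  have h0 : (0 : ℝ) < ⌈m⌉₊ := by exact_mod_cast Nat.ceil_pos.2 (by linarith)
  have h1 : (solCount (ans i) acc : ℝ) ≤ size i := by exact_mod_cast solCount_le (ans i) acc
  have ht' : (0 : ℝ) < solCount (ans i) acc := by exact_mod_cast ht
  have hN' : (0 : ℝ) < size i := ht'.trans_le h1
  rw [div_le_iff₀ h0]
  refine sum_cos_sq_le (by positivity) (div_le_one_of_le₀ h1 hN'.le) ?_
  have h2 : 2 * (solCount (ans i) acc / size i : ℝ) * (⌈m⌉₊ : ℝ) ^ 2 =
      2 * solCount (ans i) acc * (⌈m⌉₊ : ℝ) ^ 2 / size i := by ring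
  rw [h2, le_div_iff₀ hN', one_mul]
  refine hN.trans ?_
  gcongr
  exact Nat.le_ceil m

/-! ### BBHT -/

theorem bbhtLoop_succ_of_le {m : ℝ} (n : ℕ) (hm : m ≤ 2 * Real.sqrt (size i)) {τ q τ' q' : ℝ}
    (h : SearchBound ans (randomBelow m >>= fun j => grover i acc 1 j) (IsSol ans i acc) τ q)
    (h' : SearchBound ans (bbhtLoop i acc n (8 / 7 * m)) (IsSol ans i acc) τ' q')
    (hτ' : 0 ≤ τ') (hq' : 0 ≤ q') :
    SearchBound ans (bbhtLoop i acc (n + 1) m) (IsSol ans i acc) (1 + (τ + q * τ')) (q * q') := by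
  rw [bbhtLoop]
  refine SearchBound.mono (SearchBound.ticks_bind (SearchBound.bind_assoc
    (h.orElse h' hτ' hq' (k := fun o => match o with
      | some x => pure (some x)
      | none => bbhtLoop i acc n (8 / 7 * m)) (fun x => rfl) rfl)) 1 ?_) (by norm_num) le_rfl
  exact if_pos hm

theorem bbhtLoop_succ_of_lt {m : ℝ} (n : ℕ) (hm : 2 * Real.sqrt (size i) < m) :
    SearchBound ans (bbhtLoop i acc (n + 1) m) (IsSol ans i acc) 1 1 := by
  rw [bbhtLoop]
  refine SearchBound.mono (SearchBound.ticks_bind SearchBound.none 1 ?_) (by norm_num) le_rfl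
  exact if_neg hm.not_ge

/-- A round costs `1 + 7 m ≤ 8 m`, which is the drop of the potential `128 √N - 56 m` when `m`
becomes `8 m / 7`. As `64 m ≤ 128 √N` inside the loop, the potential stays nonnegative; the extra 1
pays for the final test. -/
theorem searchBound_bbhtLoop (n : ℕ) {m : ℝ} (hm : 1 ≤ m) :
    SearchBound ans (bbhtLoop i acc n m) (IsSol ans i acc)
      (1 + max 0 (128 * Real.sqrt (size i) - 56 * m)) 1 := by
  induction n generalizing m with
  | zero => exact SearchBound.none.mono (by positivity) le_rfl
  | succ n ih =>
    rcases le_or_gt m (2 * Real.sqrt (size i)) with h | h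
    · refine (bbhtLoop_succ_of_le ans i acc n h (searchBound_random_grover ans i acc hm)
        (ih (m := 8 / 7 * m) (by linarith)) (by positivity) zero_le_one).mono ?_ (by norm_num)
      rw [max_eq_right (by linarith), max_eq_right (by linarith)]
      linarith
    · refine (bbhtLoop_succ_of_lt ans i acc n h).mono ?_ le_rfl
      linarith [le_max_left 0 (128 * Real.sqrt (size i) - 56 * m)]

/-- The threshold is `κ = √(N / (2t))`. From there on a round fails with probability at most `3 /
4`, and `8 m + 3 / 4 * 64 m = 56 m` closes the time bound. The failure bound `m² / (4N)` survives
because `3 / 4 * (8 / 7)² ≤ 1`, and it reaches 1 on exit. Below `κ` rounds are charged in full,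
without credit for success; the first `m` above it is at most `8 κ / 7`, whence `32 / 49 * (N / t)`.
The hypothesis `hn` lets the loop condition end the loop before the round counter does. -/
theorem searchBound_bbhtLoop_of_pos (ht : 0 < solCount (ans i) acc) (n : ℕ) {m : ℝ} (hm : 1 ≤ m)
    (hn : 2 * Real.sqrt (size i) < m * (8 / 7) ^ n) :
    SearchBound ans (bbhtLoop i acc n m) (IsSol ans i acc)
      (max (56 * m) (128 * Real.sqrt (size i / (2 * solCount (ans i) acc)) - 56 * m))
      (max (m ^ 2) (32 / 49 * (size i / solCount (ans i) acc)) / (4 * size i)) := by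
  have h1 : (solCount (ans i) acc : ℝ) ≤ size i := by exact_mod_cast solCount_le (ans i) acc
  have ht' : (0 : ℝ) < solCount (ans i) acc := by exact_mod_cast ht
  have hN' : (0 : ℝ) < size i := ht'.trans_le h1
  set t : ℝ := ((solCount (ans i) acc : ℕ) : ℝ) with htdef
  set κ := Real.sqrt (size i / (2 * t)) with hκ
  have hκ2 : κ ^ 2 = 1 / 2 * (size i / t) := by
    rw [hκ, Real.sq_sqrt (by positivity)]; field_simp
  have hκ0 : 0 ≤ κ := Real.sqrt_nonneg _
  have hend : ∀ {m : ℝ}, 1 ≤ m → 2 * Real.sqrt (size i) < m →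
      1 ≤ max (m ^ 2) (32 / 49 * (size i / t)) / (4 * size i) := by
    intro m hm h
    rw [le_div_iff₀ (by positivity), one_mul]
    refine le_trans ?_ (le_max_left _ _)
    calc 4 * (size i : ℝ) = (2 * Real.sqrt (size i)) ^ 2 := by
          rw [mul_pow, Real.sq_sqrt hN'.le]; norm_num
      _ ≤ m ^ 2 := by gcongr
  induction n generalizing m with
  | zero =>
    refine SearchBound.none.mono (le_max_of_le_left (by linarith)) (hend hm (by simpa using hn))
  | succ n ih =>
    rcases le_or_gt m (2 * Real.sqrt (size i)) with h | h
    · have ih' := ih (m := 8 / 7 * m) (by linarith) (by rw [pow_succ] at hn; linarith)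
      have h0 : 0 ≤ max (56 * (8 / 7 * m)) (128 * κ - 56 * (8 / 7 * m)) :=
        le_max_of_le_left (by linarith)
      rcases le_or_gt κ m with hc | hc
      · have hm2 : κ ^ 2 ≤ m ^ 2 := by gcongr
        refine (bbhtLoop_succ_of_le ans i acc n h (searchBound_random_grover_of_le ans i acc hm ht
          ?_) ih' h0 (by positivity)).mono ?_ ?_
        · rw [hκ2] at hm2
          have := mul_le_mul_of_nonneg_left hm2 (by positivity : 0 ≤ 2 * t)
          have e : 2 * t * (1 / 2 * ((size i : ℝ) / t)) = size i := by field_simp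
          rw [e] at this
          exact this
        · refine le_max_of_le_left ?_
          have : max (56 * (8 / 7 * m)) (128 * κ - 56 * (8 / 7 * m)) ≤ 64 * m :=
            max_le (by linarith) (by linarith)
          linarith
        · have e : max ((8 / 7 * m) ^ 2) (32 / 49 * (size i / t)) = 64 / 49 * m ^ 2 := by
            rw [max_eq_left (by nlinarith)]; ring
          rw [e, ← mul_div_assoc]
          gcongr
          refine le_max_of_le_left ?_
          nlinarith [sq_nonneg m]
      · have hm2 : m ^ 2 ≤ κ ^ 2 := by gcongr
        refine (bbhtLoop_succ_of_le ans i acc n h (searchBound_random_grover ans i acc hm)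
          ih' h0 (by positivity)).mono ?_ ?_
        · refine le_max_of_le_right ?_
          have : max (56 * (8 / 7 * m)) (128 * κ - 56 * (8 / 7 * m)) ≤ 128 * κ - 64 * m :=
            max_le (by linarith) (by linarith)
          linarith
        · rw [one_mul]
          refine div_le_div_of_nonneg_right
            (max_le (le_max_of_le_right ?_) (le_max_right _ _)) (by positivity)
          nlinarith
    · exact (bbhtLoop_succ_of_lt ans i acc n h).mono (le_max_of_le_left (by linarith)) (hend hm h)

theorem searchBound_bbht :
    SearchBound ans (bbht i acc) (IsSol ans i acc) (1 + 128 * Real.sqrt (size i)) 1 := by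
  refine (searchBound_bbhtLoop ans i acc _ le_rfl).mono ?_ le_rfl
  gcongr
  exact max_le (by positivity) (by linarith)

/-- Justifies the round counter of `bbht`: `(8 / 7) ^ 14 ≥ 3`, and Bernoulli gives `3 ^ n ≥ 1 + 2
n`. -/
theorem two_mul_sqrt_lt_pow (n : ℕ) : 2 * Real.sqrt n < (8 / 7) ^ (14 * n + 1) := by
  have h1 : (1 + (n : ℝ) * 2) ≤ ((8 / 7) ^ 14) ^ n :=
    (one_add_mul_le_pow (a := 2) (by norm_num) n).trans (by gcongr; norm_num)
  have h2 : 2 * Real.sqrt n ≤ 1 + n * 2 := by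
    have := Real.sq_sqrt (Nat.cast_nonneg n : (0 : ℝ) ≤ n)
    nlinarith [sq_nonneg (Real.sqrt n - 1)]
  rw [pow_succ, pow_mul]
  nlinarith

theorem one_le_sqrt_div {a b : ℝ} (hb : 0 < b) (h : b ≤ a) : 1 ≤ Real.sqrt (a / b) := by
  rw [Real.one_le_sqrt, le_div_iff₀ hb]; linarith

theorem searchBound_bbht_of_pos (ht : 0 < solCount (ans i) acc) :
    SearchBound ans (bbht i acc) (IsSol ans i acc)
      (128 * Real.sqrt (size i / solCount (ans i) acc)) (1 / (4 * solCount (ans i) acc)) := by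
  have h1 : (solCount (ans i) acc : ℝ) ≤ size i := by exact_mod_cast solCount_le (ans i) acc
  have ht' : (0 : ℝ) < solCount (ans i) acc := by exact_mod_cast ht
  have hN' : (0 : ℝ) < size i := ht'.trans_le h1
  refine (searchBound_bbhtLoop_of_pos ans i acc ht _ le_rfl
    (by rw [one_mul]; exact two_mul_sqrt_lt_pow _)).mono ?_ ?_
  · have h2 := one_le_sqrt_div ht' h1
    refine max_le (by linarith) ?_
    have : Real.sqrt (size i / (2 * solCount (ans i) acc)) ≤
        Real.sqrt (size i / solCount (ans i) acc) := by
      gcongr; linarith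
    linarith
  · have h2 : 1 ≤ (size i : ℝ) / solCount (ans i) acc := by
      rw [le_div_iff₀ ht']; linarith
    have h3 : max (1 ^ 2) (32 / 49 * ((size i : ℝ) / solCount (ans i) acc)) ≤
        (size i : ℝ) / solCount (ans i) acc := max_le (by linarith) (by linarith)
    calc _ ≤ (size i : ℝ) / solCount (ans i) acc / (4 * size i) := by gcongr
      _ = _ := by field_simp

end Subroutines

/-! ### BCWZ -/

/-- The lower bound makes the argument of the ceiling in `exactIter` nonnegative; the upper one
follows from `arcsin s ≥ s` and `π < 4`. -/
theorem pi_div_four_mul_arcsin_le {s : ℝ} (h0 : 0 < s) (h1 : s ≤ 1) :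
    1 / 2 ≤ Real.pi / (4 * Real.arcsin s) ∧ Real.pi / (4 * Real.arcsin s) ≤ 1 / s := by
  have hp : 0 < Real.arcsin s := Real.arcsin_pos.2 h0
  have hl : s ≤ Real.arcsin s := by
    have := Real.sin_le hp.le
    rwa [Real.sin_arcsin (by linarith) h1] at this
  constructor
  · rw [le_div_iff₀ (by positivity)]
    linarith [Real.arcsin_le_pi_div_two s]
  · rw [div_le_div_iff₀ (by positivity) h0, one_mul]
    nlinarith [Real.pi_lt_four]

theorem exactIter_le {N t : ℕ} (h0 : 0 < t) (h1 : t ≤ N) :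
    (exactIter N t : ℝ) ≤ Real.sqrt (N / t) + 1 / 2 := by
  have ht : (0 : ℝ) < t := by exact_mod_cast h0
  have htN : (t : ℝ) ≤ N := by exact_mod_cast h1
  have hN : (0 : ℝ) < N := ht.trans_le htN
  obtain ⟨h2, h3⟩ := pi_div_four_mul_arcsin_le (s := Real.sqrt (t / N)) (by positivity)
    (Real.sqrt_le_one.2 (div_le_one_of_le₀ htN hN.le))
  have h4 : 1 / Real.sqrt ((t : ℝ) / N) = Real.sqrt (N / t) := by
    rw [one_div, ← Real.sqrt_inv, inv_div]
  rw [h4] at h3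
  have := Nat.ceil_lt_add_one
    (by linarith : 0 ≤ Real.pi / (4 * Real.arcsin (Real.sqrt ((t : ℝ) / N))) - 1 / 2)
  rw [exactIter]
  linarith

/-- By the choice of `exactIter` the angle is at most `arcsin √(t / N)`. So the weight required is
at most 1, and the projection onto `[0, 1]` does not change it. -/
theorem sin_sq_eq_exactWeight {N t : ℕ} (h0 : 0 < t) (h1 : t ≤ N) :
    Real.sin (Real.pi / (2 * (2 * exactIter N t + 1))) ^ 2 = exactWeight N t * t / N := by
  have ht : (0 : ℝ) < t := by exact_mod_cast h0
  have htN : (t : ℝ) ≤ N := by exact_mod_cast h1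
  have hN : (0 : ℝ) < N := ht.trans_le htN
  have hs0 : 0 < Real.sqrt ((t : ℝ) / N) := by positivity
  have hs1 : Real.sqrt ((t : ℝ) / N) ≤ 1 := Real.sqrt_le_one.2 (div_le_one_of_le₀ htN hN.le)
  have hp : 0 < Real.arcsin (Real.sqrt ((t : ℝ) / N)) := Real.arcsin_pos.2 hs0
  have h2 : Real.pi / (2 * (2 * (exactIter N t : ℝ) + 1)) ≤
      Real.arcsin (Real.sqrt (t / N)) := by
    have := Nat.le_ceil (Real.pi / (4 * Real.arcsin (Real.sqrt ((t : ℝ) / N))) - 1 / 2)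
    rw [← exactIter, sub_le_iff_le_add, div_le_iff₀ (by positivity)] at this
    rw [div_le_iff₀ (by positivity)]
    linarith
  have h3 : Real.sin (Real.pi / (2 * (2 * (exactIter N t : ℝ) + 1))) ≤ Real.sqrt (t / N) := by
    rw [← Real.sin_arcsin (by linarith) hs1]
    exact Real.sin_le_sin_of_le_of_le_pi_div_two
      (by linarith [show 0 ≤ Real.pi / (2 * (2 * (exactIter N t : ℝ) + 1)) by positivity,
        Real.pi_pos]) (Real.arcsin_le_pi_div_two _) h2
  have h4 : 0 ≤ Real.sin (Real.pi / (2 * (2 * (exactIter N t : ℝ) + 1))) :=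
    Real.sin_nonneg_of_nonneg_of_le_pi (by positivity)
      (h2.trans (by linarith [Real.arcsin_le_pi_div_two (Real.sqrt ((t : ℝ) / N)), Real.pi_pos]))
  have h5 : Real.sin (Real.pi / (2 * (2 * (exactIter N t : ℝ) + 1))) ^ 2 ≤ t / N := by
    rw [← Real.sq_sqrt (by positivity : (0 : ℝ) ≤ t / N)]
    gcongr
  rw [exactWeight, Set.projIcc_of_mem zero_le_one ⟨by positivity,
    div_le_one_of_le₀ h5 (by positivity)⟩]
  field_simp

section Subroutines

variable (ans : (i : Fin V) → Fin (size i) → R) (i : Fin V) (acc : Fin (size i) → R → Bool)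

/-- For the right count the final angle is exactly `π / 2`. With `r = √(N / s) ≥ 1` the time is at
most `4 (r + 1 / 2) + 4 ≤ 10 r`. -/
theorem searchBound_grover_exact {s : ℕ} (h0 : 0 < s) (h1 : s ≤ size i) :
    SearchBound ans (grover i acc (exactWeight (size i) s) (exactIter (size i) s))
      (IsSol ans i acc) (10 * Real.sqrt (size i / s))
      (if solCount (ans i) acc = s then 0 else 1) := by
  have hr := one_le_sqrt_div (a := size i) (b := s) (by exact_mod_cast h0) (by exact_mod_cast h1)
  have hτ : 4 * (exactIter (size i) s : ℝ) + 4 ≤ 10 * Real.sqrt (size i / s) := by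
    linarith [exactIter_le h0 h1]
  split_ifs with h
  · refine (searchBound_grover ans i acc (θ := Real.pi / (2 * (2 * exactIter (size i) s + 1)))
      ?_ (by omega) _).mono hτ (le_of_eq ?_)
    · rw [sin_sq_eq_exactWeight h0 h1, goodWeight_eq, ← h, solCount]
    · have : (2 * (exactIter (size i) s : ℝ) + 1) *
          (Real.pi / (2 * (2 * exactIter (size i) s + 1))) = Real.pi / 2 := by
        field_simp
      rw [this, Real.cos_pi_div_two]; norm_num
  · exact (searchBound_grover_le_one ans i acc _ _).mono hτ le_rfl

/-- A telescoping majorant for `∑ 1 / √s`. It serves the exact searches of BCWZ and the amortization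
in findall. -/
theorem inv_sqrt_le (s : ℕ) :
    1 / Real.sqrt ((s + 1 : ℕ) : ℝ) ≤ 2 * (Real.sqrt ((s + 1 : ℕ) : ℝ) - Real.sqrt s) := by
  have h1 : Real.sqrt s ≤ Real.sqrt ((s + 1 : ℕ) : ℝ) := by gcongr; omega
  have h2 : 0 < Real.sqrt ((s + 1 : ℕ) : ℝ) := by positivity
  rw [div_le_iff₀ h2]
  have h3 := Real.sq_sqrt (Nat.cast_nonneg (s + 1) : (0 : ℝ) ≤ ((s + 1 : ℕ) : ℝ))
  have h4 := Real.sq_sqrt (Nat.cast_nonneg s : (0 : ℝ) ≤ s)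
  push_cast at *
  nlinarith

/-- A round costs at most `11 √(N / s)`, test included; `inv_sqrt_le` doubles the constant. -/
theorem searchBound_exactLoop (n s : ℕ) (hn : s + n ≤ size i) :
    SearchBound ans (exactLoop i acc n (s + 1)) (IsSol ans i acc)
      (22 * Real.sqrt (size i) * (Real.sqrt ((s + n : ℕ) : ℝ) - Real.sqrt s))
      (if s < solCount (ans i) acc ∧ solCount (ans i) acc ≤ s + n then 0 else 1) := by
  induction n generalizing s with
  | zero =>
    refine SearchBound.none.mono (by simp) ?_
    rw [if_neg (by omega)]
  | succ n ih =>
    have ih' := ih (s + 1) (by omega)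
    rw [exactLoop]
    have e : s + 1 + n = s + (n + 1) := by ring
    have hmono : Real.sqrt ((s + 1 : ℕ) : ℝ) ≤ Real.sqrt ((s + 1 + n : ℕ) : ℝ) := by
      exact Real.sqrt_le_sqrt (by exact_mod_cast (by omega : s + 1 ≤ s + 1 + n))
    have hτ : 0 ≤ 22 * Real.sqrt (size i) *
        (Real.sqrt ((s + 1 + n : ℕ) : ℝ) - Real.sqrt ((s + 1 : ℕ) : ℝ)) :=
      mul_nonneg (by positivity) (by linarith)
    refine SearchBound.mono (SearchBound.ticks_bind
      ((searchBound_grover_exact ans i acc (s := s + 1) (by omega) (by omega)).orElse ih' hτ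
        (by split_ifs <;> norm_num) (k := fun o => match o with
          | some x => pure (some x)
          | none => exactLoop i acc n (s + 1 + 1)) (fun x => rfl) rfl) 1 rfl) ?_ ?_
    · have h1 : ((1 : ℕ) : ℝ) ≤ Real.sqrt (size i / (s + 1 : ℕ)) := by
        rw [Nat.cast_one]
        exact one_le_sqrt_div (by positivity) (by exact_mod_cast (by omega : s + 1 ≤ size i))
      have h2 : Real.sqrt (size i / (s + 1 : ℕ)) =
          Real.sqrt (size i) * (1 / Real.sqrt ((s + 1 : ℕ) : ℝ)) := by
        rw [Real.sqrt_div (Nat.cast_nonneg _)]; ring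
      have h3 : Real.sqrt (size i) * (1 / Real.sqrt ((s + 1 : ℕ) : ℝ)) ≤
          Real.sqrt (size i) * (2 * (Real.sqrt ((s + 1 : ℕ) : ℝ) - Real.sqrt s)) :=
        mul_le_mul_of_nonneg_left (inv_sqrt_le s) (Real.sqrt_nonneg _)
      have h4 : (if solCount (ans i) acc = s + 1 then (0 : ℝ) else 1) *
          (22 * Real.sqrt (size i) *
            (Real.sqrt ((s + 1 + n : ℕ) : ℝ) - Real.sqrt ((s + 1 : ℕ) : ℝ))) ≤
          22 * Real.sqrt (size i) *
            (Real.sqrt ((s + 1 + n : ℕ) : ℝ) - Real.sqrt ((s + 1 : ℕ) : ℝ)) :=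
        mul_le_of_le_one_left hτ (by split_ifs <;> norm_num)
      rw [← e]
      linarith
    · by_cases h : solCount (ans i) acc = s + 1
      · rw [if_pos h, zero_mul]
        split_ifs <;> norm_num
      · rw [if_neg h, one_mul]
        split_ifs with h1 h2 h2
        · norm_num
        · omega
        · omega
        · norm_num

theorem searchBound_randomLoop {m ρ : ℝ} (hm : 1 ≤ m) (hρ : 0 ≤ ρ) (hρ1 : ρ ≤ 1)
    (h : SearchBound ans (randomBelow m >>= fun j => grover i acc 1 j) (IsSol ans i acc)
      (7 * m) ρ) (n : ℕ) :
    SearchBound ans (randomLoop i acc m n) (IsSol ans i acc) (8 * m * n) (ρ ^ n) := by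
  induction n with
  | zero => exact SearchBound.none.mono (by simp) (by simp)
  | succ n ih =>
    rw [randomLoop]
    refine SearchBound.mono (SearchBound.ticks_bind (SearchBound.bind_assoc
      (h.orElse ih (by positivity) (by positivity) (k := fun o => match o with
        | some x => pure (some x)
        | none => randomLoop i acc m n) (fun x => rfl) rfl)) 1 rfl) ?_ (by rw [pow_succ'])
    have : ρ * (8 * m * n) ≤ 8 * m * n := mul_le_of_le_one_left (by positivity) hρ1
    push_cast
    linarith

/-- A bound for the time of BCWZ. -/
def bcwzTime (N : ℕ) (w : ℝ) : ℝ := 1 + 46 * Real.sqrt (N * bcwzLevel N w)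

theorem bcwzTime_nonneg (N : ℕ) (w : ℝ) : 0 ≤ bcwzTime N w := by unfold bcwzTime; positivity

theorem sqrt_div_mul_eq (N : ℝ) {T : ℝ} (hT : 0 < T) :
    Real.sqrt (N / T) * T = Real.sqrt (N * T) := by
  have : N * T = N / T * T ^ 2 := by field_simp
  rw [this, Real.sqrt_mul' _ (by positivity), Real.sqrt_sq hT.le]

/-- The constant 46 of `bcwzTime` is `22 + 24`, from the exact and the randomized searches. The
failure bound `ρ` of the latter stays free, since it is needed only above the cut-off. -/
theorem searchBound_bcwz_of_randomLoop (w : ℝ) {ρ : ℝ} (hρ : 0 ≤ ρ)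
    (h : SearchBound ans (randomLoop i acc (Real.sqrt (size i / bcwzLevel (size i) w))
      (3 * bcwzLevel (size i) w)) (IsSol ans i acc)
      (24 * Real.sqrt (size i * bcwzLevel (size i) w)) ρ) :
    SearchBound ans (bcwz i acc w) (IsSol ans i acc) (bcwzTime (size i) w)
      ((if 0 < solCount (ans i) acc ∧ solCount (ans i) acc ≤ bcwzLevel (size i) w
        then 0 else 1) * ρ) := by
  have hT : bcwzLevel (size i) w ≤ size i := min_le_left _ _
  have he := searchBound_exactLoop ans i acc (bcwzLevel (size i) w) 0 (by omega)
  simp only [zero_add, Nat.cast_zero, Real.sqrt_zero, sub_zero] at he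
  rw [bcwz]
  refine SearchBound.mono (SearchBound.ticks_bind (he.orElse h (by positivity) hρ
    (k := fun o => match o with
        | some x => pure (some x)
        | none => randomLoop i acc (Real.sqrt (size i / bcwzLevel (size i) w))
            (3 * bcwzLevel (size i) w)) (fun x => rfl) rfl) 1 rfl) ?_ le_rfl
  have : (if 0 < solCount (ans i) acc ∧ solCount (ans i) acc ≤ bcwzLevel (size i) w
      then (0 : ℝ) else 1) * (24 * Real.sqrt (size i * bcwzLevel (size i) w)) ≤
      24 * Real.sqrt (size i * bcwzLevel (size i) w) :=
    mul_le_of_le_one_left (by positivity) (by split_ifs <;> norm_num)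
  rw [bcwzTime, Real.sqrt_mul (Nat.cast_nonneg _)] at *
  push_cast
  linarith

theorem searchBound_randomLoop_level (w : ℝ) {ρ : ℝ} (hρ : 0 ≤ ρ) (hρ1 : ρ ≤ 1)
    (h : 0 < bcwzLevel (size i) w → 1 ≤ Real.sqrt (size i / bcwzLevel (size i) w) →
      SearchBound ans (randomBelow (Real.sqrt (size i / bcwzLevel (size i) w)) >>=
        fun j => grover i acc 1 j) (IsSol ans i acc)
        (7 * Real.sqrt (size i / bcwzLevel (size i) w)) ρ) :
    SearchBound ans (randomLoop i acc (Real.sqrt (size i / bcwzLevel (size i) w))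
      (3 * bcwzLevel (size i) w)) (IsSol ans i acc)
      (24 * Real.sqrt (size i * bcwzLevel (size i) w)) (ρ ^ (3 * bcwzLevel (size i) w)) := by
  have hT : bcwzLevel (size i) w ≤ size i := min_le_left _ _
  -- At level 0 there are no rounds, so the meaningless quotient by 0 is never used.
  rcases Nat.eq_zero_or_pos (bcwzLevel (size i) w) with h0 | h0
  · rw [h0]
    exact SearchBound.none.mono (by simp) (by simp)
  · have hT0 : (0 : ℝ) < bcwzLevel (size i) w := by exact_mod_cast h0
    have h1 := one_le_sqrt_div (a := size i) hT0 (by exact_mod_cast hT)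
    refine (searchBound_randomLoop ans i acc h1 hρ hρ1 (h h0 h1) _).mono ?_ le_rfl
    rw [← sqrt_div_mul_eq _ hT0]
    push_cast
    linarith

theorem searchBound_bcwz (w : ℝ) :
    SearchBound ans (bcwz i acc w) (IsSol ans i acc) (bcwzTime (size i) w) 1 := by
  refine (searchBound_bcwz_of_randomLoop ans i acc w (by positivity)
    (searchBound_randomLoop_level ans i acc w zero_le_one le_rfl fun _ h =>
      searchBound_random_grover ans i acc h)).mono le_rfl ?_
  rw [one_pow, mul_one]
  split_ifs <;> norm_num

/-- Up to `T` solutions, one of the exact searches is certain to succeed. Beyond that `T < N`, so `T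
= ⌈lg w⌉`, and `3 T` random searches all fail with probability at most `(27 / 64) ^ T ≤ 2 ^ (-T) ≤ 1
/ w`. -/
theorem searchBound_bcwz_of_pos {w : ℝ} (hw : 1 < w) (ht : 0 < solCount (ans i) acc) :
    SearchBound ans (bcwz i acc w) (IsSol ans i acc) (bcwzTime (size i) w) (1 / w) := by
  have hw0 : 0 ≤ 1 / w := by positivity
  by_cases hc : solCount (ans i) acc ≤ bcwzLevel (size i) w
  · refine (searchBound_bcwz_of_randomLoop ans i acc w (by positivity)
      (searchBound_randomLoop_level ans i acc w zero_le_one le_rfl fun _ h =>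
        searchBound_random_grover ans i acc h)).mono le_rfl ?_
    rw [if_pos ⟨ht, hc⟩, zero_mul]
    exact hw0
  · refine (searchBound_bcwz_of_randomLoop ans i acc w (by positivity)
      (searchBound_randomLoop_level ans i acc w (ρ := 3 / 4) (by norm_num) (by norm_num)
        fun h0 h => searchBound_random_grover_of_le ans i acc h ht ?_)).mono le_rfl ?_
    · have hT0 : (0 : ℝ) < bcwzLevel (size i) w := by exact_mod_cast h0
      have hc' : (bcwzLevel (size i) w : ℝ) ≤ solCount (ans i) acc := by
        exact_mod_cast (by omega : bcwzLevel (size i) w ≤ solCount (ans i) acc)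
      rw [Real.sq_sqrt (by positivity), ← mul_div_assoc, le_div_iff₀ hT0]
      have : (size i : ℝ) * bcwzLevel (size i) w ≤ size i * solCount (ans i) acc := by gcongr
      have : (0 : ℝ) ≤ size i * solCount (ans i) acc := by positivity
      linarith
    · have hN := solCount_le (ans i) acc
      have hT : bcwzLevel (size i) w = ⌈Real.logb 2 w⌉₊ := by
        rw [bcwzLevel] at hc ⊢; omega
      have h1 : w ≤ 2 ^ bcwzLevel (size i) w := by
        rw [hT, ← Real.rpow_natCast]
        calc w = 2 ^ Real.logb 2 w :=
              (Real.rpow_logb (by norm_num) (by norm_num) (by linarith)).symm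
          _ ≤ _ := Real.rpow_le_rpow_of_exponent_le (by norm_num) (Nat.le_ceil _)
      calc _ ≤ 1 * ((3 / 4 : ℝ) ^ 3) ^ bcwzLevel (size i) w := by
            rw [pow_mul]
            gcongr
            split_ifs <;> norm_num
        _ ≤ 1 * (1 / 2) ^ bcwzLevel (size i) w := by gcongr; norm_num
        _ = 1 / 2 ^ bcwzLevel (size i) w := by rw [one_div_pow, one_mul]
        _ ≤ 1 / w := by gcongr

/-! ### findsol -/

theorem searchBound_findsol_of_bbht_of_bcwz (w : ℝ) {τ q τ' q' : ℝ} (hτ : 0 ≤ τ) (hq : 0 ≤ q)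
    (hτ' : 0 ≤ τ') (hq' : 0 ≤ q')
    (h : SearchBound ans (bbht i acc) (IsSol ans i acc) τ q)
    (h' : SearchBound ans (bcwz i acc w) (IsSol ans i acc) τ' q') :
    SearchBound ans (findsol i acc w) (IsSol ans i acc) (τ + q * (τ + q * τ'))
      (q * (q * q')) := by
  have h2 := h.orElse h' hτ' hq' (k := fun o => match o with
      | some x => pure (some x)
      | none => bcwz i acc w) (fun x => rfl) rfl
  exact h.orElse h2 (by positivity) (by positivity) (fun x => rfl) rfl

theorem searchBound_findsol (w : ℝ) :
    SearchBound ans (findsol i acc w) (IsSol ans i acc)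
      (2 + 256 * Real.sqrt (size i) + bcwzTime (size i) w) 1 := by
  have := bcwzTime_nonneg (size i) w
  refine (searchBound_findsol_of_bbht_of_bcwz ans i acc w (by positivity) zero_le_one this
    zero_le_one (searchBound_bbht ans i acc) (searchBound_bcwz ans i acc w)).mono ?_ (by norm_num)
  linarith

/-- Two BBHT runs square `1 / (4 t)`, which makes the probability of reaching BCWZ summable over
`t`; a single run would leave a harmonic sum. -/
theorem searchBound_findsol_of_pos {w : ℝ} (hw : 1 < w) (ht : 0 < solCount (ans i) acc) :
    SearchBound ans (findsol i acc w) (IsSol ans i acc)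
      (256 * Real.sqrt (size i / solCount (ans i) acc) +
        1 / (16 * (solCount (ans i) acc : ℝ) ^ 2) * bcwzTime (size i) w)
      (1 / (16 * (solCount (ans i) acc : ℝ) ^ 2) * (1 / w)) := by
  have hT := bcwzTime_nonneg (size i) w
  have ht' : (1 : ℝ) ≤ solCount (ans i) acc := by exact_mod_cast ht
  refine (searchBound_findsol_of_bbht_of_bcwz ans i acc w (by positivity) (by positivity) hT
    (by positivity) (searchBound_bbht_of_pos ans i acc ht)
    (searchBound_bcwz_of_pos ans i acc hw ht)).mono ?_ (le_of_eq ?_)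
  · have h1 : 1 / (4 * (solCount (ans i) acc : ℝ)) *
        (128 * Real.sqrt (size i / solCount (ans i) acc)) ≤
        128 * Real.sqrt (size i / solCount (ans i) acc) :=
      mul_le_of_le_one_left (by positivity) (div_le_one_of_le₀ (by linarith) (by positivity))
    have h2 : 1 / (4 * (solCount (ans i) acc : ℝ)) *
        (1 / (4 * (solCount (ans i) acc : ℝ)) * bcwzTime (size i) w) =
        1 / (16 * (solCount (ans i) acc : ℝ) ^ 2) * bcwzTime (size i) w := by
      field_simp; ring
    rw [mul_add, h2]
    linarith
  · field_simp; norm_num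

end Subroutines

/-! ### findall -/

/-- The search problem of findall when the solutions in `H` have been found. -/
abbrev residual {R : Type} (acc : Fin N → R → Bool) (H : List (Fin N)) (x : Fin N) (r : R) :
    Bool :=
  acc x r && !decide (x ∈ H)

/-- A list of different solutions. -/
def IsSolList {R : Type} (ans : Fin N → R) (acc : Fin N → R → Bool) (H : List (Fin N)) : Prop :=
  H.Nodup ∧ ∀ x ∈ H, acc x (ans x) = true

section Lists

variable {R : Type} {ans : Fin N → R} {acc : Fin N → R → Bool} {H : List (Fin N)}

theorem IsSolList.append_singleton (h : IsSolList ans acc H) {x : Fin N}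
    (hx : residual acc H x (ans x) = true) : IsSolList ans acc (H ++ [x]) := by
  simp only [residual, Bool.and_eq_true, Bool.not_eq_true', decide_eq_false_iff_not] at hx
  refine ⟨List.nodup_append.2 ⟨h.1, List.nodup_singleton x, ?_⟩, ?_⟩
  · rintro a ha b hb rfl
    rw [List.mem_singleton] at hb
    exact hx.2 (hb ▸ ha)
  · intro y hy
    rcases List.mem_append.1 hy with hy | hy
    · exact h.2 y hy
    · rw [List.mem_singleton.1 hy]; exact hx.1

theorem solCount_residual_append {x : Fin N} (hx : residual acc H x (ans x) = true) :
    solCount ans (residual acc H) = solCount ans (residual acc (H ++ [x])) + 1 := by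
  simp only [residual, Bool.and_eq_true, Bool.not_eq_true', decide_eq_false_iff_not] at hx
  rw [solCount, solCount, ← Finset.card_insert_of_notMem (a := x)]
  · congr 1
    ext y
    by_cases hy : y = x
    · subst hy; simp [hx.1, hx.2]
    · simp [hy]
  · simp

theorem length_le_solCount {xs : List (Fin N)} (h : IsSolList ans acc (H ++ xs)) :
    xs.length ≤ solCount ans (residual acc H) := by
  obtain ⟨h1, h2, h3⟩ := List.nodup_append.1 h.1
  rw [← List.toFinset_card_of_nodup h2]
  refine Finset.card_le_card fun x hx => ?_
  rw [List.mem_toFinset] at hx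
  have h4 : x ∉ H := fun hH => h3 x hH x hx rfl
  simp [h4, h.2 x (List.mem_append_right H hx)]

theorem mem_of_solCount_residual_eq_zero (h : solCount ans (residual acc H) = 0) {x : Fin N}
    (hx : acc x (ans x) = true) : x ∈ H := by
  by_contra hH
  have := Finset.card_eq_zero.1 h
  have h2 : x ∈ (Finset.univ.filter fun x => residual acc H x (ans x) = true) := by
    simp [hx, hH]
  rw [this] at h2
  simp at h2

end Lists

/-- A majorant of the sum of `1 / (16 s ^ 2)` over `1 ≤ s ≤ t`. -/
def tailSum (t : ℕ) : ℝ := 1 / 8 * (1 - 1 / (t + 1))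

theorem tailSum_nonneg (t : ℕ) : 0 ≤ tailSum t := by
  have : 1 / ((t : ℝ) + 1) ≤ 1 := div_le_one_of_le₀ (by linarith [Nat.cast_nonneg (α := ℝ) t])
    (by positivity)
  unfold tailSum
  linarith

theorem tailSum_le (t : ℕ) : tailSum t ≤ 1 := by
  have : 0 ≤ 1 / ((t : ℝ) + 1) := by positivity
  unfold tailSum
  linarith

/-- For `s = t + 1`, `1 / (16 s²) ≤ 1 / (8 s (s + 1))`, and the right side telescopes. -/
theorem tailSum_add_le (t : ℕ) :
    tailSum t + 1 / (16 * ((t + 1 : ℕ) : ℝ) ^ 2) ≤ tailSum (t + 1) := by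
  have h : 1 / (16 * ((t : ℝ) + 1) ^ 2) ≤ 1 / (8 * (t + 1) * (t + 2)) := by
    apply one_div_le_one_div_of_le (by positivity)
    nlinarith [Nat.cast_nonneg (α := ℝ) t]
  have h2 : 1 / (8 * ((t : ℝ) + 1) * (t + 2)) = 1 / 8 * (1 / (t + 1) - 1 / (t + 2)) := by
    field_simp; ring
  unfold tailSum
  push_cast
  rw [add_assoc (t : ℝ) 1 1, one_add_one_eq_two]
  linarith

section Findall

variable (ans : (i : Fin V) → Fin (size i) → R) (i : Fin V) (acc : Fin (size i) → R → Bool)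

theorem cost_findallLoop_succ (c w : ℝ) (n : ℕ) (H : List (Fin (size i)))
    (f : List (Fin (size i)) → ℝ) :
    (findallLoop i acc w (n + 1) H).cost c ans f =
      (findsol i (residual acc H) w).cost c ans fun o => match o with
        | some x => c * 2 + (findallLoop i acc w n (H ++ [x])).cost c ans f
        | none => c * (H.length + 1) + f H := by
  rw [findallLoop, cost_monad_bind]
  congr 1
  funext o
  cases o <;> simp

/-- The failure probability of findall. -/
theorem cost_findallLoop_le_of_complete {w : ℝ} (hw : 1 < w) {f : List (Fin (size i)) → ℝ}
    {A B : ℝ} (hB : 0 ≤ B)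
    (hA : ∀ H, IsSolList (ans i) acc H → (∀ x, IsSol ans i acc x → x ∈ H) → f H ≤ A)
    (hAB : ∀ H, IsSolList (ans i) acc H → f H ≤ A + B)
    (n : ℕ) (H : List (Fin (size i))) (hH : IsSolList (ans i) acc H)
    (hn : solCount (ans i) (residual acc H) < n) :
    (findallLoop i acc w n H).cost 0 ans f ≤
      A + tailSum (solCount (ans i) (residual acc H)) * (1 / w) * B := by
  induction n generalizing H with
  | zero => omega
  | succ n ih =>
    rw [cost_findallLoop_succ]
    have hw0 : 0 < 1 / w := by positivity
    rcases Nat.eq_zero_or_pos (solCount (ans i) (residual acc H)) with h0 | h0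
    · have hc : ∀ x, IsSol ans i acc x → x ∈ H := fun x =>
        mem_of_solCount_residual_eq_zero h0
      -- With no solution left, `none` is the right outcome: the penalty is 0, and `some x` cannot
      -- occur.
      refine (searchBound_findsol ans i (residual acc H) w 0 A 0 _ le_rfl le_rfl ?_ ?_).trans ?_
      · intro x hx
        have := solCount_residual_append hx
        omega
      · simpa using hA H hH hc
      · have := tailSum_nonneg (solCount (ans i) (residual acc H))
        have : 0 ≤ tailSum (solCount (ans i) (residual acc H)) * (1 / w) * B := by positivity
        linarith
    · obtain ⟨s, hs⟩ : ∃ s, solCount (ans i) (residual acc H) = s + 1 :=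
        Nat.exists_eq_add_one.2 h0
      have h1 := tailSum_nonneg s
      have h2 : 0 ≤ tailSum s * (1 / w) * B := by positivity
      refine (searchBound_findsol_of_pos ans i (residual acc H) hw h0 0
        (A + tailSum s * (1 / w) * B) B _ le_rfl hB ?_ ?_).trans ?_
      · intro x hx
        have h3 := solCount_residual_append hx
        have h4 := ih (H ++ [x]) (hH.append_singleton hx) (by omega)
        rw [show solCount (ans i) (residual acc (H ++ [x])) = s by omega] at h4
        simpa using h4
      · have := hAB H hH
        simp only [zero_mul, zero_add]
        linarith
      · rw [hs]
        have h5 := mul_le_mul_of_nonneg_right (mul_le_mul_of_nonneg_right (tailSum_add_le s)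
          hw0.le) hB
        linarith

/-- The expected time of findall, by amortization over the length of the result. -/
theorem cost_findallLoop_le {w : ℝ} (hw : 1 < w) {f : List (Fin (size i)) → ℝ}
    (n : ℕ) (H : List (Fin (size i))) (hH : IsSolList (ans i) acc H)
    (hn : solCount (ans i) (residual acc H) < n) {M : ℝ}
    (hM : ∀ xs, IsSolList (ans i) acc (H ++ xs) →
      f (H ++ xs) + (H ++ xs).length + 600 * (Real.sqrt (size i) * Real.sqrt xs.length) ≤ M) :
    (findallLoop i acc w n H).cost 1 ans f ≤
      M + (3 + 256 * Real.sqrt (size i) + bcwzTime (size i) w +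
        tailSum (solCount (ans i) (residual acc H)) * bcwzTime (size i) w) := by
  have hQ := bcwzTime_nonneg (size i) w
  induction n generalizing H M with
  | zero => omega
  | succ n ih =>
    rw [cost_findallLoop_succ]
    have hH0 := hM [] (by simpa using hH)
    simp only [List.append_nil, List.length_nil, Nat.cast_zero, Real.sqrt_zero, mul_zero,
      add_zero] at hH0
    rcases Nat.eq_zero_or_pos (solCount (ans i) (residual acc H)) with h0 | h0
    · refine (searchBound_findsol ans i (residual acc H) w 1 (M + 1) 0 _ zero_le_one le_rfl
        ?_ ?_).trans ?_
      · intro x hx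
        have := solCount_residual_append hx
        omega
      · simp only [one_mul]
        linarith
      · have := tailSum_nonneg (solCount (ans i) (residual acc H))
        have : 0 ≤ tailSum (solCount (ans i) (residual acc H)) * bcwzTime (size i) w := by
          positivity
        linarith
    · obtain ⟨s, hs⟩ : ∃ s, solCount (ans i) (residual acc H) = s + 1 :=
        Nat.exists_eq_add_one.2 h0
      have hle := solCount_le (ans i) (residual acc H)
      have h1 := tailSum_nonneg s
      have ht0 : (0 : ℝ) < solCount (ans i) (residual acc H) := by exact_mod_cast h0
      have hr := one_le_sqrt_div (a := size i) ht0 (by exact_mod_cast hle)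
      set r := Real.sqrt (size i / solCount (ans i) (residual acc H)) with hrdef
      have h2 : 0 ≤ tailSum s * bcwzTime (size i) w := by positivity
      -- A success lowers `M` by `300 r`; the penalty `300 r` restores it if the search gives up
      -- early. The balance is `256 r + 300 r / 16 + 2 ≤ 300 r`.
      refine (searchBound_findsol_of_pos ans i (residual acc H) hw h0 1
        (2 + (M - 300 * r) + (3 + 256 * Real.sqrt (size i) + bcwzTime (size i) w +
          tailSum s * bcwzTime (size i) w)) (300 * r) _ zero_le_one (by positivity)
          ?_ ?_).trans ?_
      · intro x hx
        have h3 := solCount_residual_append hx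
        have h4 := ih (H ++ [x]) (hH.append_singleton hx) (by omega) (M := M - 300 * r) ?_
        · rw [show solCount (ans i) (residual acc (H ++ [x])) = s by omega] at h4
          simp only [one_mul]
          linarith
        · intro xs hxs
          rw [List.append_assoc, List.singleton_append] at hxs ⊢
          have h5 := hM (x :: xs) hxs
          have h6 := length_le_solCount hxs
          rw [List.length_cons] at h5 h6
          have h7 := inv_sqrt_le xs.length
          -- If `x :: xs` is still to be found, at least `xs.length + 1` solutions remain. So `300
          -- r` is at most the difference of the terms `600 √N √n` for `n = xs.length + 1` and `n =
          -- xs.length`.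
          have h8 : r ≤ Real.sqrt (size i) * (1 / Real.sqrt ((xs.length + 1 : ℕ) : ℝ)) := by
            rw [hrdef, mul_one_div, ← Real.sqrt_div (Nat.cast_nonneg _)]
            gcongr
          have h9 := mul_le_mul_of_nonneg_left h7 (Real.sqrt_nonneg (size i))
          linarith
      · simp only [one_mul]
        have : 0 ≤ Real.sqrt (size i) := Real.sqrt_nonneg _
        linarith
      · have h5 := mul_le_mul_of_nonneg_right (tailSum_add_le s) hQ
        have ht1 : (1 : ℝ) ≤ solCount (ans i) (residual acc H) := by exact_mod_cast h0
        have h6 : 1 / (16 * (solCount (ans i) (residual acc H) : ℝ) ^ 2) * (1 / w) ≤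
            1 / 16 * 1 := by
          gcongr
          · nlinarith
          · exact div_le_one_of_le₀ hw.le (by linarith)
        have h7 := mul_le_mul_of_nonneg_right h6 (by positivity : 0 ≤ 300 * r)
        rw [hs] at h7 hrdef ⊢
        rw [← hrdef]
        linarith

theorem cost_findall_le_of_complete {w : ℝ} (hw : 1 < w) {f : List (Fin (size i)) → ℝ}
    {A B : ℝ} (hB : 0 ≤ B)
    (hA : ∀ H, IsSolList (ans i) acc H → (∀ x, IsSol ans i acc x → x ∈ H) → f H ≤ A)
    (hAB : ∀ H, IsSolList (ans i) acc H → f H ≤ A + B) :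
    (findall i acc w).cost 0 ans f ≤ A + 1 / w * B := by
  refine (cost_findallLoop_le_of_complete ans i acc hw hB hA hAB _ []
    ⟨List.nodup_nil, by simp⟩ (Nat.lt_succ_of_le (solCount_le _ _))).trans ?_
  gcongr
  exact mul_le_of_le_one_left (by positivity) (tailSum_le _)

theorem cost_findall_le {w : ℝ} (hw : 1 < w) {f : List (Fin (size i)) → ℝ} {M : ℝ}
    (hM : ∀ xs, IsSolList (ans i) acc xs →
      f xs + xs.length + 600 * (Real.sqrt (size i) * Real.sqrt xs.length) ≤ M) :
    (findall i acc w).cost 1 ans f ≤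
      M + (3 + 256 * Real.sqrt (size i) + 2 * bcwzTime (size i) w) := by
  refine (cost_findallLoop_le ans i acc hw _ [] ⟨List.nodup_nil, by simp⟩
    (Nat.lt_succ_of_le (solCount_le _ _)) (M := M) (by simpa using hM)).trans ?_
  have := mul_le_of_le_one_left (bcwzTime_nonneg (size i) w)
    (tailSum_le (solCount (ans i) (residual acc [])))
  linarith

end Findall

/-! ### The main loop of breadth-first search -/

/-- The search problem of `bfsLoop` at the vertex `i`. -/
abbrev newAcc {R : Type} (dest : (i : Fin V) → Fin (size i) → R → Option (Fin V)) (i : Fin V)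
    (vis : Finset (Fin V)) (x : Fin (size i)) (r : R) : Bool :=
  match dest i x r with
  | some u => !decide (u ∈ vis)
  | none => false

/-- The vertices found. -/
def newVertices {R : Type} (dest : (i : Fin V) → Fin (size i) → R → Option (Fin V))
    (ans : (i : Fin V) → Fin (size i) → R) (i : Fin V) (xs : List (Fin (size i))) :
    List (Fin V) :=
  xs.filterMap fun x => dest i x (ans i x)

section NewVertices

variable {R : Type} {dest : (i : Fin V) → Fin (size i) → R → Option (Fin V)}
  {ans : (i : Fin V) → Fin (size i) → R} {i : Fin V} {vis : Finset (Fin V)}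
  {xs : List (Fin (size i))}

theorem newAcc_eq_true_iff {x : Fin (size i)} {r : R} :
    newAcc dest i vis x r = true ↔ ∃ u, dest i x r = some u ∧ u ∉ vis := by
  unfold newAcc
  cases dest i x r <;> simp

theorem length_newVertices (h : IsSolList (ans i) (newAcc dest i vis) xs) :
    (newVertices dest ans i xs).length = xs.length := by
  obtain ⟨-, h⟩ := h
  induction xs with
  | nil => rfl
  | cons x xs ih =>
    obtain ⟨u, hu, -⟩ := newAcc_eq_true_iff.1 (h x (by simp))
    have := ih fun y hy => h y (by simp [hy])
    rw [newVertices] at this ⊢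
    simp [hu, this]

theorem notMem_of_mem_newVertices (h : IsSolList (ans i) (newAcc dest i vis) xs) {u : Fin V}
    (hu : u ∈ newVertices dest ans i xs) : u ∉ vis := by
  obtain ⟨x, hx, hxu⟩ := List.mem_filterMap.1 hu
  obtain ⟨v, hv, hvis⟩ := newAcc_eq_true_iff.1 (h.2 x hx)
  rw [hv, Option.some_inj] at hxu
  exact hxu ▸ hvis

theorem nodup_newVertices (h : IsSolList (ans i) (newAcc dest i vis) xs)
    (hinj : ∀ x y u, dest i x (ans i x) = some u → dest i y (ans i y) = some u → x = y) :
    (newVertices dest ans i xs).Nodup :=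
  h.1.filterMap fun x y u hx hy => hinj x y u hx hy

/-- Found vertices move from the unmarked set to the queue. Hence queue length plus number of
unmarked vertices drops by exactly one per visit, which bounds the number of calls of findall. -/
theorem card_compl_union_newVertices (h : IsSolList (ans i) (newAcc dest i vis) xs)
    (hinj : ∀ x y u, dest i x (ans i x) = some u → dest i y (ans i y) = some u → x = y) :
    (vis ∪ (newVertices dest ans i xs).toFinset)ᶜ.card + xs.length = visᶜ.card := by
  have h1 : visᶜ = (vis ∪ (newVertices dest ans i xs).toFinset)ᶜ ∪
      (newVertices dest ans i xs).toFinset := by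
    ext u
    have := @notMem_of_mem_newVertices _ _ _ _ _ _ _ _ h u
    simp only [Finset.mem_compl, Finset.mem_union, List.mem_toFinset]
    tauto
  have h2 : Disjoint (vis ∪ (newVertices dest ans i xs).toFinset)ᶜ
      (newVertices dest ans i xs).toFinset :=
    Finset.disjoint_left.2 fun u hu hu' => by
      rw [Finset.mem_compl, Finset.mem_union] at hu
      exact hu (Or.inr hu')
  conv_rhs => rw [h1]
  rw [Finset.card_union_of_disjoint h2, List.toFinset_card_of_nodup (nodup_newVertices h hinj),
    length_newVertices h]

theorem sum_compl_union_newVertices (h : IsSolList (ans i) (newAcc dest i vis) xs)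
    (hinj : ∀ x y u, dest i x (ans i x) = some u → dest i y (ans i y) = some u → x = y)
    (g : Fin V → ℝ) :
    ∑ u ∈ (vis ∪ (newVertices dest ans i xs).toFinset)ᶜ, g u +
      ((newVertices dest ans i xs).map g).sum = ∑ u ∈ visᶜ, g u := by
  have h1 : visᶜ = (vis ∪ (newVertices dest ans i xs).toFinset)ᶜ ∪
      (newVertices dest ans i xs).toFinset := by
    ext u
    have := @notMem_of_mem_newVertices _ _ _ _ _ _ _ _ h u
    simp only [Finset.mem_compl, Finset.mem_union, List.mem_toFinset]
    tauto
  have h2 : Disjoint (vis ∪ (newVertices dest ans i xs).toFinset)ᶜ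
      (newVertices dest ans i xs).toFinset :=
    Finset.disjoint_left.2 fun u hu hu' => by
      rw [Finset.mem_compl, Finset.mem_union] at hu
      exact hu (Or.inr hu')
  conv_rhs => rw [h1]
  rw [Finset.sum_union h2, List.sum_toFinset _ (nodup_newVertices h hinj)]

end NewVertices

section Loop

variable (dest : (i : Fin V) → Fin (size i) → R → Option (Fin V))
  (ans : (i : Fin V) → Fin (size i) → R)

theorem cost_enqueueAll (c : ℝ) (i : Fin V) (xs : List (Fin (size i))) (q : List (Fin V))
    (vis : Finset (Fin V)) (f : List (Fin V) × Finset (Fin V) → ℝ) :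
    (enqueueAll dest i xs q vis).cost c ans f = c * (3 * xs.length) +
      f (q ++ newVertices dest ans i xs, vis ∪ (newVertices dest ans i xs).toFinset) := by
  induction xs generalizing q vis with
  | nil => simp [enqueueAll, newVertices]
  | cons x xs ih =>
    rw [enqueueAll]
    simp only [cost_monad_bind, cost_ask, cost_ticks]
    cases hx : dest i x (ans i x) with
    | none =>
      simp only [ih, newVertices, List.filterMap_cons, hx]
      push_cast [List.length_cons]
      ring
    | some u =>
      simp only [ih, newVertices, List.filterMap_cons, hx, List.append_assoc,
        List.singleton_append, List.toFinset_cons, Finset.insert_union, Finset.union_insert]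
      push_cast [List.length_cons]
      ring

theorem cost_bfsLoop_nil (c w : ℝ) (n : ℕ) (vis : Finset (Fin V)) (out : List (Fin V))
    (f : List (Fin V) → ℝ) :
    (bfsLoop dest w (n + 1) [] vis out).cost c ans f = c + f out := by
  rw [bfsLoop]
  simp

theorem cost_bfsLoop_cons (c w : ℝ) (n : ℕ) (i : Fin V) (q : List (Fin V))
    (vis : Finset (Fin V)) (out : List (Fin V)) (f : List (Fin V) → ℝ) :
    (bfsLoop dest w (n + 1) (i :: q) vis out).cost c ans f = c * 3 +
      (findall i (newAcc dest i vis) w).cost c ans fun xs => c * (3 * xs.length) +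
        (bfsLoop dest w n (q ++ newVertices dest ans i xs)
          (vis ∪ (newVertices dest ans i xs).toFinset) (out ++ [i])).cost c ans f := by
  rw [bfsLoop]
  simp only [cost_monad_bind, cost_ticks, cost_enqueueAll]
  push_cast
  rw [← add_assoc]
  congr 1
  ring

variable {dest ans}
  (hinj : ∀ i x y u, dest i x (ans i x) = some u → dest i y (ans i y) = some u → x = y)
include hinj

/-- The failure probability of the main loop. -/
theorem cost_bfsLoop_le_of_classicalRun {G : Digraph (Fin V)}
    (hadj : ∀ i u, G.Adj i u ↔ ∃ x, dest i x (ans i x) = some u) {w : ℝ} (hw : 1 < w)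
    {f : List (Fin V) → ℝ} (hf : ∀ l, f l ≤ 1) (n : ℕ) (q : List (Fin V))
    (vis : Finset (Fin V)) (out : List (Fin V)) (hn : q.length + visᶜ.card < n)
    (h : ∀ l, ClassicalRun G q vis l → f (out ++ l) ≤ 0) :
    (bfsLoop dest w n q vis out).cost 0 ans f ≤ (q.length + visᶜ.card) * (1 / w) := by
  induction n generalizing q vis out with
  | zero => omega
  | succ n ih =>
    have hw0 : 0 < 1 / w := by positivity
    cases q with
    | nil =>
      rw [cost_bfsLoop_nil]
      have := h [] (.done vis)
      rw [List.append_nil] at this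
      have : 0 ≤ (([] : List (Fin V)).length + visᶜ.card : ℝ) * (1 / w) := by positivity
      linarith
    | cons i q =>
      rw [cost_bfsLoop_cons]
      have h0 : 0 ≤ (q.length + visᶜ.card : ℝ) * (1 / w) := by positivity
      -- Union bound: an incomplete result here is charged 1 with probability `1 / w`; a complete
      -- one is a step of `ClassicalRun`.
      refine (add_le_add_right (cost_findall_le_of_complete ans i (newAcc dest i vis) hw
        (A := (q.length + visᶜ.card) * (1 / w)) (B := 1) zero_le_one ?_ ?_) _).trans
        (le_of_eq ?_)
      · intro xs hxs hc
        have h1 := card_compl_union_newVertices hxs (hinj i)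
        have h2 := length_newVertices hxs
        rw [List.length_cons] at hn
        have h3 := ih (q ++ newVertices dest ans i xs)
          (vis ∪ (newVertices dest ans i xs).toFinset) (out ++ [i])
          (by rw [List.length_append, h2]; omega) fun l hl => by
            rw [List.append_assoc, List.singleton_append]
            refine h _ (.visit i q vis _ l (nodup_newVertices hxs (hinj i)) (fun u => ?_) hl)
            constructor
            · intro hu
              refine ⟨(hadj i u).2 ?_, notMem_of_mem_newVertices hxs hu⟩
              obtain ⟨x, -, hxu⟩ := List.mem_filterMap.1 hu
              exact ⟨x, hxu⟩
            · rintro ⟨hu, hvis⟩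
              obtain ⟨x, hx⟩ := (hadj i u).1 hu
              exact List.mem_filterMap.2 ⟨x, hc x (newAcc_eq_true_iff.2 ⟨u, hx, hvis⟩), hx⟩
        rw [zero_mul, zero_add]
        refine h3.trans (le_of_eq ?_)
        rw [← h1, List.length_append, h2]
        push_cast
        ring
      · intro xs _
        have := Prog.cost_zero_le ans (bfsLoop dest w n (q ++ newVertices dest ans i xs)
          (vis ∪ (newVertices dest ans i xs).toFinset) (out ++ [i])) hf
        linarith
      · rw [List.length_cons]
        push_cast
        ring

/-- The expected time of the main loop. Each vertex in the queue carries a credit of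
`8 + e i`, each unmarked vertex a credit of `e i + 306 / μ`. -/
theorem cost_bfsLoop_le {w μ L : ℝ} (hw : 1 < w) (hμ : 0 < μ) (hL : 1 ≤ L)
    (hT : ∀ i, (bcwzLevel (size i) w : ℝ) ≤ L) {e : Fin V → ℝ}
    (he : ∀ i, e i = 480 * (μ * size i) + 174 * (L / μ)) (n : ℕ) (q : List (Fin V))
    (vis : Finset (Fin V)) (out : List (Fin V)) :
    (bfsLoop dest w n q vis out).cost 1 ans (fun _ => 0) ≤
      1 + (q.map fun u => 8 + e u).sum + ∑ u ∈ visᶜ, (e u + 306 / μ) := by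
  have he0 : ∀ i, 0 ≤ e i := fun i => by rw [he]; positivity
  -- Weighted AM-GM with one `μ` for all rounds replaces the Cauchy-Schwarz inequality over the
  -- whole run: it is linear, so each vertex can pay its share.
  have amgm : ∀ a b : ℝ, 0 ≤ a → 0 ≤ b → Real.sqrt a * Real.sqrt b ≤ (μ * a + b / μ) / 2 := by
    intro a b ha hb
    have h1 : Real.sqrt a * Real.sqrt b = Real.sqrt (μ * a) * Real.sqrt (b / μ) := by
      rw [← Real.sqrt_mul ha, ← Real.sqrt_mul (by positivity)]
      congr 1
      field_simp
    have h2 := two_mul_le_add_sq (Real.sqrt (μ * a)) (Real.sqrt (b / μ))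
    rw [Real.sq_sqrt (by positivity), Real.sq_sqrt (by positivity)] at h2
    linarith
  have hnonneg : ∀ (q : List (Fin V)) (vis : Finset (Fin V)),
      0 ≤ (q.map fun u => 8 + e u).sum + ∑ u ∈ visᶜ, (e u + 306 / μ) := by
    intro q vis
    refine add_nonneg (List.sum_nonneg ?_) (Finset.sum_nonneg fun u _ => ?_)
    · intro y hy
      obtain ⟨u, -, rfl⟩ := List.mem_map.1 hy
      linarith [he0 u]
    · have := he0 u
      positivity
  induction n generalizing q vis out with
  | zero =>
    have := hnonneg q vis
    change (0 : ℝ) ≤ _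
    linarith
  | succ n ih =>
    cases q with
    | nil =>
      rw [cost_bfsLoop_nil]
      have := hnonneg [] vis
      linarith
    | cons i q =>
      rw [cost_bfsLoop_cons]
      have hc := cost_findall_le ans i (newAcc dest i vis) hw
        (f := fun xs => 1 * (3 * xs.length) +
        (bfsLoop dest w n (q ++ newVertices dest ans i xs)
          (vis ∪ (newVertices dest ans i xs).toFinset) (out ++ [i])).cost 1 ans fun _ => 0)
        (M := 1 + (q.map fun u => 8 + e u).sum + ∑ u ∈ visᶜ, (e u + 306 / μ) +
          306 * (μ * size i)) ?_
      -- Constants of the queue credit: `8 = 3 + 5`, `256 + 2 * 46 = 2 * 174`, `480 = 306 + 174`.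
      · have h1 : Real.sqrt (size i) ≤ Real.sqrt (size i) * Real.sqrt L :=
          le_mul_of_one_le_right (Real.sqrt_nonneg _) (Real.one_le_sqrt.2 hL)
        have h2 : Real.sqrt (size i * bcwzLevel (size i) w) ≤
            Real.sqrt (size i) * Real.sqrt L := by
          rw [← Real.sqrt_mul (Nat.cast_nonneg _)]
          gcongr
          exact hT i
        have h3 := amgm (size i) L (Nat.cast_nonneg _) (by linarith)
        rw [bcwzTime] at hc
        rw [List.map_cons, List.sum_cons]
        have h4 := he i
        linarith
      · intro xs hxs
        have h1 := ih (q ++ newVertices dest ans i xs)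
          (vis ∪ (newVertices dest ans i xs).toFinset) (out ++ [i])
        have h2 := sum_compl_union_newVertices hxs (hinj i) fun u => e u + 306 / μ
        have h3 := length_newVertices hxs
        have h4 : ∀ l : List (Fin V), (l.map fun u => 8 + e u).sum =
            (l.map fun u => e u + 306 / μ).sum + l.length * (8 - 306 / μ) := by
          intro l
          induction l with
          | nil => simp
          | cons u l ih =>
            rw [List.map_cons, List.sum_cons, ih, List.map_cons, List.sum_cons, List.length_cons]
            push_cast
            ring
        rw [List.map_append, List.sum_append, h4 (newVertices dest ans i xs), h3] at h1
        have h5 : (xs.length : ℝ) ≤ size i := by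
          have := List.Nodup.length_le_card hxs.1
          rw [Fintype.card_fin] at this
          exact_mod_cast this
        -- Per new vertex: 3 for enqueueing, 1 for wiping its mark in findall, 8 as queue credit.
        -- These 12 join the 600 to give `612 = 2 * 306`; the part `306 / μ` is released when the
        -- vertex is marked.
        have h6 : (xs.length : ℝ) ≤ Real.sqrt (size i) * Real.sqrt xs.length := by
          calc (xs.length : ℝ) = Real.sqrt xs.length * Real.sqrt xs.length :=
                (Real.mul_self_sqrt (Nat.cast_nonneg _)).symm
            _ ≤ _ := by gcongr
        have h7 := amgm (size i) xs.length (Nat.cast_nonneg _) (Nat.cast_nonneg _)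
        have h8 : (xs.length : ℝ) * (8 - 306 / μ) = 8 * xs.length - 306 * (xs.length / μ) := by
          ring
        rw [h8] at h1
        linarith

end Loop

/-! ### Bounds for `bfs` itself. -/

section Main

variable {dest : (i : Fin V) → Fin (size i) → R → Option (Fin V)}
  {ans : (i : Fin V) → Fin (size i) → R}

theorem one_lt_card_div (a : Fin V) {ε : ℝ} (h0 : 0 < ε) (h1 : ε < 1) : 1 < V / ε := by
  have : (1 : ℝ) ≤ V := by exact_mod_cast (by have := a.2; omega : 1 ≤ V)
  rw [lt_div_iff₀ h0]
  linarith

theorem cost_bfs_le_of_classicalRun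
    (hinj : ∀ i x y u, dest i x (ans i x) = some u → dest i y (ans i y) = some u → x = y)
    {G : Digraph (Fin V)} (hadj : ∀ i u, G.Adj i u ↔ ∃ x, dest i x (ans i x) = some u)
    (a : Fin V) {ε : ℝ} (h0 : 0 < ε) (h1 : ε < 1) {f : List (Fin V) → ℝ} (hf : ∀ l, f l ≤ 1)
    (h : ∀ l, ClassicalRun G [a] {a} l → f l ≤ 0) :
    (bfs dest a ε).cost 0 ans f ≤ ε := by
  have hV : 1 ≤ V := by have := a.2; omega
  have hV' : (V : ℝ) ≠ 0 := by positivity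
  have hc : ({a} : Finset (Fin V))ᶜ.card = V - 1 := by
    rw [Finset.card_compl, Finset.card_singleton, Fintype.card_fin]
  rw [bfs, cost_monad_bind, cost_ticks, zero_mul, zero_add]
  refine (cost_bfsLoop_le_of_classicalRun hinj hadj (one_lt_card_div a h0 h1) hf (V + 1) [a] {a}
    [] (by rw [hc, List.length_singleton]; omega) (by simpa using h)).trans (le_of_eq ?_)
  rw [hc, List.length_singleton, Nat.cast_sub hV]
  push_cast
  field_simp
  ring

/-- The choice `μ = √(V L / S)` makes `μ S` and `V L / μ` both equal to `√(V S L)`. The constants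
are `11 = 2 + 1 + 8` and `960 = 480 + 174 + 306`. -/
theorem cost_bfs_le
    (hinj : ∀ i x y u, dest i x (ans i x) = some u → dest i y (ans i y) = some u → x = y)
    (a : Fin V) {ε L : ℝ} (h0 : 0 < ε) (h1 : ε < 1) (hL : 1 ≤ L)
    (hT : Real.logb 2 (V / ε) + 1 ≤ L) {S : ℕ} (hS : S = ∑ i, size i) (hS0 : 0 < S) :
    (bfs dest a ε).cost 1 ans (fun _ => 0) ≤ 11 + 960 * Real.sqrt (V * S * L) := by
  have hw := one_lt_card_div a h0 h1
  have hV : (0 : ℝ) < V := by exact_mod_cast (by have := a.2; omega : 0 < V)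
  have hS0' : (0 : ℝ) < S := by exact_mod_cast hS0
  have hlog : 0 ≤ Real.logb 2 (V / ε) := Real.logb_nonneg (by norm_num) hw.le
  have hT' : ∀ i, (bcwzLevel (size i) (V / ε) : ℝ) ≤ L := fun i =>
    calc (bcwzLevel (size i) (V / ε) : ℝ) ≤ ⌈Real.logb 2 (V / ε)⌉₊ := by
          exact_mod_cast min_le_right _ _
      _ ≤ Real.logb 2 (V / ε) + 1 := (Nat.ceil_lt_add_one hlog).le
      _ ≤ L := hT
  set μ := Real.sqrt (V * L / S) with hμdef
  have hμ : 0 < μ := by positivity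
  have hμ1 : μ * S = Real.sqrt (V * S * L) := by
    rw [hμdef, sqrt_div_mul_eq _ hS0']
    congr 1
    ring
  have hμ2 : V * (L / μ) = Real.sqrt (V * S * L) := by
    have : μ ^ 2 = V * L / S := Real.sq_sqrt (by positivity)
    rw [← hμ1]
    field_simp
    rw [this]
    field_simp
  have hμ3 : V * (1 / μ) ≤ Real.sqrt (V * S * L) := by
    rw [← hμ2]; gcongr
  rw [bfs, cost_monad_bind, cost_ticks]
  have key := cost_bfsLoop_le hinj hw hμ hL hT' (e := fun i => 480 * (μ * size i) + 174 * (L / μ))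
    (fun _ => rfl) (V + 1) [a] {a} []
  have hsum : ∑ u, (480 * (μ * size u) + 174 * (L / μ) + 306 / μ) =
      480 * (μ * S) + 174 * (V * (L / μ)) + 306 * (V * (1 / μ)) := by
    rw [hS]
    simp only [Finset.sum_add_distrib, ← Finset.mul_sum, Finset.sum_const, Finset.card_univ,
      Fintype.card_fin, nsmul_eq_mul]
    push_cast
    ring
  rw [← Finset.sum_add_sum_compl {a}, Finset.sum_singleton] at hsum
  simp only [List.map_cons, List.map_nil, List.sum_cons, List.sum_nil] at key
  have : 0 < 306 / μ := by positivity
  push_cast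
  linarith

end Main

end

/-! ### Classical breadth-first search -/

section Classical

variable {V : ℕ} {G : Digraph (Fin V)} {a : Fin V}

theorem distance_le {n : ℕ} {v : Fin V} (h : WalkOfLength G n a v) : distance G a v ≤ n :=
  Nat.sInf_le h

theorem walkOfLength_distance {v : Fin V} (h : ∃ n, WalkOfLength G n a v) :
    WalkOfLength G (distance G a v) a v :=
  Nat.sInf_mem (s := {n | WalkOfLength G n a v}) h

theorem distance_le_succ {v u : Fin V} (h : ∃ n, WalkOfLength G n a v) (e : G.Adj v u) :
    distance G a u ≤ distance G a v + 1 :=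
  distance_le ((walkOfLength_distance h).step e)

theorem exists_adj_of_distance_eq_succ {x : Fin V} {d : ℕ} (h : ∃ n, WalkOfLength G n a x)
    (hd : distance G a x = d + 1) :
    ∃ y, (∃ n, WalkOfLength G n a y) ∧ distance G a y ≤ d ∧ G.Adj y x := by
  have hw := walkOfLength_distance h
  rw [hd] at hw
  cases hw with
  | step hw e => exact ⟨_, ⟨_, hw⟩, distance_le hw, e⟩

/-- The invariant of breadth-first search: `dn` is the list of the vertices visited, `q` the
queue, `vis` the set of marked vertices. -/
structure BFSInvariant (G : Digraph (Fin V)) (a : Fin V) (dn q : List (Fin V))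
    (vis : Finset (Fin V)) : Prop where
  nodup : (dn ++ q).Nodup
  mem_iff : ∀ v, v ∈ vis ↔ v ∈ dn ++ q
  closed : ∀ u ∈ dn, ∀ v, G.Adj u v → v ∈ vis
  reach : ∀ v ∈ vis, ∃ n, WalkOfLength G n a v
  source_mem : a ∈ vis
  sorted : (dn ++ q).Pairwise fun u v => distance G a u ≤ distance G a v
  le_head_succ : ∀ h t, q = h :: t → ∀ v ∈ t, distance G a v ≤ distance G a h + 1
  -- Reachability must be assumed: an unreachable vertex has `distance` 0, the infimum of the empty
  -- set.
  mem_of_le_head : ∀ h t, q = h :: t → ∀ v, (∃ n, WalkOfLength G n a v) →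
    distance G a v ≤ distance G a h → v ∈ vis

theorem BFSInvariant.start : BFSInvariant G a [] [a] {a} where
  nodup := by simp
  mem_iff := by simp
  closed := by simp
  reach v hv := by
    rw [Finset.mem_singleton] at hv
    subst hv
    exact ⟨0, .zero v⟩
  source_mem := by simp
  sorted := by simp
  le_head_succ h t e v hv := by
    obtain ⟨rfl, rfl⟩ := List.cons_eq_cons.1 e
    simp at hv
  mem_of_le_head h t e v hv hd := by
    obtain ⟨rfl, rfl⟩ := List.cons_eq_cons.1 e
    have h0 : distance G a a ≤ 0 := distance_le (.zero a)
    have hw := walkOfLength_distance hv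
    rw [show distance G a v = 0 by omega] at hw
    cases hw
    simp

/-- New vertices have distance exactly `d(v) + 1`: at most by the edge from `v`, at least because
everything up to distance `d(v)` is already marked. So the queue always spans at most two
consecutive levels. -/
theorem BFSInvariant.visit {dn q new : List (Fin V)} {v : Fin V} {vis : Finset (Fin V)}
    (h : BFSInvariant G a dn (v :: q) vis) (nodup : new.Nodup)
    (mem : ∀ u, u ∈ new ↔ G.Adj v u ∧ u ∉ vis) :
    BFSInvariant G a (dn ++ [v]) (q ++ new) (vis ∪ new.toFinset) := by
  have hvis : v ∈ vis := (h.mem_iff v).2 (by simp)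
  have hreach := h.reach v hvis
  have hnew : ∀ u ∈ new, distance G a u = distance G a v + 1 := by
    intro u hu
    obtain ⟨e, hn⟩ := (mem u).1 hu
    refine le_antisymm (distance_le_succ hreach e) ?_
    by_contra hlt
    exact hn (h.mem_of_le_head v q rfl u ⟨_, (walkOfLength_distance hreach).step e⟩ (by omega))
  have hassoc : dn ++ [v] ++ (q ++ new) = (dn ++ v :: q) ++ new := by simp
  obtain ⟨-, hsq, hdq⟩ := List.pairwise_append.1 h.sorted
  rw [List.pairwise_cons] at hsq
  have hq : ∀ u ∈ q ++ new,
      distance G a v ≤ distance G a u ∧ distance G a u ≤ distance G a v + 1 := by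
    intro u hu
    rcases List.mem_append.1 hu with hu | hu
    · exact ⟨hsq.1 u hu, h.le_head_succ v q rfl u hu⟩
    · have := hnew u hu
      omega
  have hsorted : (dn ++ [v] ++ (q ++ new)).Pairwise
      fun u v => distance G a u ≤ distance G a v := by
    rw [hassoc, List.pairwise_append]
    refine ⟨h.sorted, ?_, ?_⟩
    · exact List.pairwise_of_forall_mem_list fun x hx y hy => by rw [hnew x hx, hnew y hy]
    · intro x hx u hu
      rw [hnew u hu]
      rcases List.mem_append.1 hx with hx | hx
      · exact (hdq x hx v (by simp)).trans (Nat.le_succ _)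
      · rcases List.mem_cons.1 hx with rfl | hx
        · exact Nat.le_succ _
        · exact h.le_head_succ v q rfl x hx
  refine ⟨?_, ?_, ?_, ?_, Finset.mem_union_left _ h.source_mem, hsorted, ?_, ?_⟩
  · rw [hassoc, List.nodup_append]
    refine ⟨h.nodup, nodup, ?_⟩
    rintro x hx y hy rfl
    exact ((mem x).1 hy).2 ((h.mem_iff x).2 hx)
  · intro u
    rw [hassoc, List.mem_append, Finset.mem_union, List.mem_toFinset, h.mem_iff]
  · intro u hu x e
    rw [Finset.mem_union, List.mem_toFinset]
    rcases List.mem_append.1 hu with hu | hu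
    · exact Or.inl (h.closed u hu x e)
    · rw [List.mem_singleton] at hu
      subst hu
      by_cases hx : x ∈ vis
      · exact Or.inl hx
      · exact Or.inr ((mem x).2 ⟨e, hx⟩)
  · intro u hu
    rw [Finset.mem_union, List.mem_toFinset] at hu
    rcases hu with hu | hu
    · exact h.reach u hu
    · exact ⟨_, (walkOfLength_distance hreach).step ((mem u).1 hu).1⟩
  · intro y t e u hu
    have h1 := (hq u (by rw [e]; exact List.mem_cons_of_mem _ hu)).2
    have h2 := (hq y (by rw [e]; exact List.mem_cons_self)).1
    omega
  · intro y t e x hx hd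
    rw [Finset.mem_union, List.mem_toFinset]
    rcases le_or_gt (distance G a x) (distance G a v) with hle | hlt
    · exact Or.inl (h.mem_of_le_head v q rfl x hx hle)
    · have h2 := (hq y (by rw [e]; exact List.mem_cons_self)).2
      -- The predecessor `z` of `x` on a shortest walk is marked. Were it still queued behind `v`,
      -- sortedness would put the new head `y` at distance at most `d(v)`, below that of `x`.
      obtain ⟨z, hz, hzd, hzx⟩ := exists_adj_of_distance_eq_succ (d := distance G a v) hx (by omega)
      have hzv := (h.mem_iff z).1 (h.mem_of_le_head v q rfl z hz hzd)
      rcases List.mem_append.1 hzv with hz' | hz'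
      · exact Or.inl (h.closed z hz' x hzx)
      · rcases List.mem_cons.1 hz' with rfl | hz'
        · by_cases hx : x ∈ vis
          · exact Or.inl hx
          · exact Or.inr ((mem x).2 ⟨hzx, hx⟩)
        · exfalso
          have h3 := (List.pairwise_append.1 hsorted).2.1
          have h4 : z ∈ q ++ new := List.mem_append_left _ hz'
          rw [e] at h3 h4
          rcases List.mem_cons.1 h4 with rfl | h4
          · omega
          · have := (List.pairwise_cons.1 h3).1 z h4
            omega

/-- When the queue is empty, the visited vertices contain the source and are closed under edges,
hence contain everything reachable. -/
theorem BFSInvariant.of_classicalRun {dn q l : List (Fin V)} {vis : Finset (Fin V)}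
    (hr : ClassicalRun G q vis l) (h : BFSInvariant G a dn q vis) :
    (dn ++ l).Nodup ∧ (∀ v, v ∈ dn ++ l ↔ ∃ n, WalkOfLength G n a v) ∧
      (dn ++ l).Pairwise fun u v => distance G a u ≤ distance G a v := by
  induction hr generalizing dn with
  | done vis =>
    refine ⟨h.nodup, fun v => ⟨fun hv => h.reach v ((h.mem_iff v).2 hv), ?_⟩, h.sorted⟩
    rintro ⟨n, hn⟩
    rw [← h.mem_iff]
    induction hn with
    | zero => exact h.source_mem
    | step hw e ih =>
      refine h.closed _ ?_ _ e
      simpa using (h.mem_iff _).1 (ih h)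
  | visit v q vis new l nodup mem rest ih => simpa using ih (h.visit nodup mem)

/-- Classical breadth-first search visits each reachable vertex once, in order of distance. -/
theorem ClassicalRun.isBreadthFirstSearch {l : List (Fin V)} (h : ClassicalRun G [a] {a} l) :
    IsBreadthFirstSearch G a l := by
  obtain ⟨h1, h2, h3⟩ := BFSInvariant.start.of_classicalRun h
  exact ⟨h, h1, h2, h3⟩

end Classical

/-! ### The two graph models -/

section Models

variable {V : ℕ} {size : Fin V → ℕ} {R : Type} [Fintype R] [DecidableEq R] [AddCommGroup R]
  {dest : (i : Fin V) → Fin (size i) → R → Option (Fin V)}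
  {ans : (i : Fin V) → Fin (size i) → R}

theorem failureProb_bfs_le
    (hinj : ∀ i x y u, dest i x (ans i x) = some u → dest i y (ans i y) = some u → x = y)
    {G : Digraph (Fin V)} (hadj : ∀ i u, G.Adj i u ↔ ∃ x, dest i x (ans i x) = some u)
    (a : Fin V) {ε : ℝ} (h0 : 0 < ε) (h1 : ε < 1) :
    (bfs dest a ε).failureProb ans (IsBreadthFirstSearch G a) ≤ ENNReal.ofReal ε := by
  classical
  rw [failureProb_eq_cost]
  refine ENNReal.ofReal_le_ofReal (cost_bfs_le_of_classicalRun hinj hadj a h0 h1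
    (fun l => by split_ifs <;> norm_num) fun l hl => ?_)
  rw [if_pos hl.isBreadthFirstSearch]

/-- For `V ≥ 2` the coefficients are absorbed into a power of `V`, so that `lg (1 / ε)` is at most a
multiple of `lg V` depending on `p` alone. -/
theorem exists_eval_le_rpow (p : Polynomial ℝ) :
    ∃ K : ℝ, 0 ≤ K ∧ ∀ V : ℕ, 2 ≤ V → p.eval (V : ℝ) ≤ (V : ℝ) ^ K := by
  obtain ⟨k, hk⟩ : ∃ k : ℕ, ∑ i ∈ p.support, |p.coeff i| ≤ 2 ^ k := by
    obtain ⟨k, hk⟩ := pow_unbounded_of_one_lt (∑ i ∈ p.support, |p.coeff i|) one_lt_two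
    exact ⟨k, hk.le⟩
  refine ⟨(k + p.natDegree : ℕ), by positivity, fun V hV => ?_⟩
  have hV' : (2 : ℝ) ≤ V := by exact_mod_cast hV
  rw [Real.rpow_natCast, pow_add, Polynomial.eval_eq_sum, Polynomial.sum]
  calc ∑ i ∈ p.support, p.coeff i * (V : ℝ) ^ i
      ≤ ∑ i ∈ p.support, |p.coeff i| * (V : ℝ) ^ p.natDegree := by
        refine Finset.sum_le_sum fun i hi => ?_
        have h1 : (V : ℝ) ^ i ≤ (V : ℝ) ^ p.natDegree :=
          pow_le_pow_right₀ (by linarith) (Polynomial.le_natDegree_of_mem_supp i hi)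
        exact (mul_le_mul_of_nonneg_right (le_abs_self _) (by positivity)).trans
          (mul_le_mul_of_nonneg_left h1 (abs_nonneg _))
    _ = (∑ i ∈ p.support, |p.coeff i|) * (V : ℝ) ^ p.natDegree := by rw [Finset.sum_mul]
    _ ≤ (V : ℝ) ^ k * (V : ℝ) ^ p.natDegree := by
        gcongr
        exact hk.trans (by gcongr)

theorem logb_div_add_one_le {V : ℕ} (hV : 2 ≤ V) {ε K P : ℝ} (h0 : 0 < ε) (hP : ε⁻¹ ≤ P)
    (hK : P ≤ (V : ℝ) ^ K) :
    Real.logb 2 (V / ε) + 1 ≤ (K + 2) * Real.logb 2 V := by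
  have hV' : (2 : ℝ) ≤ V := by exact_mod_cast hV
  have hl : 1 ≤ Real.logb 2 V := by
    rw [Real.le_logb_iff_rpow_le (by norm_num) (by linarith)]
    simpa using hV'
  have h1 : Real.logb 2 ε⁻¹ ≤ K * Real.logb 2 V := by
    rw [← Real.logb_rpow_eq_mul_logb_of_pos (by linarith)]
    exact Real.logb_le_logb_of_le (by norm_num) (by positivity) (hP.trans hK)
  rw [div_eq_mul_inv, Real.logb_mul (by positivity) (by positivity)]
  linarith

/-- The hypotheses `E ≤ ∑ size ≤ 2 E` cover directed and undirected counting at once. The square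
root is at least 1 and absorbs the additive 11, whence `971 = 960 + 11`. -/
theorem expectedTime_bfs_le
    (hinj : ∀ i x y u, dest i x (ans i x) = some u → dest i y (ans i y) = some u → x = y)
    (a : Fin V) {ε K P : ℝ} (h0 : 0 < ε) (h1 : ε < 1) (hK0 : 0 ≤ K) (hV : 2 ≤ V)
    (hP : ε⁻¹ ≤ P) (hK : P ≤ (V : ℝ) ^ K) {E : ℕ} (hE0 : 0 < E)
    (hE : E ≤ ∑ i, size i) (hE' : ∑ i, size i ≤ 2 * E) :
    (bfs dest a ε).expectedTime ans ≤
      ENNReal.ofReal (971 * (2 * (K + 2)) * Real.sqrt (V * E * Real.logb 2 V)) := by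
  have hV' : (2 : ℝ) ≤ V := by exact_mod_cast hV
  have hl : 1 ≤ Real.logb 2 V := by
    rw [Real.le_logb_iff_rpow_le (by norm_num) (by linarith)]
    simpa using hV'
  rw [expectedTime_eq_cost]
  refine ENNReal.ofReal_le_ofReal ((cost_bfs_le hinj a h0 h1 (L := (K + 2) * Real.logb 2 V)
    (by nlinarith) (logb_div_add_one_le hV h0 hP hK) rfl (by omega)).trans ?_)
  have hEr : (1 : ℝ) ≤ E := by exact_mod_cast hE0
  have hEr' : ((∑ i, size i : ℕ) : ℝ) ≤ 2 * E := by exact_mod_cast hE'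
  have h2 : (1 : ℝ) ≤ Real.sqrt (V * E * Real.logb 2 V) := by
    rw [Real.one_le_sqrt]
    have : (1 : ℝ) ≤ V * E := by nlinarith
    nlinarith
  have h3 : Real.sqrt (V * (∑ i, size i : ℕ) * ((K + 2) * Real.logb 2 V)) ≤
      2 * (K + 2) * Real.sqrt (V * E * Real.logb 2 V) := by
    have h4 : V * ((∑ i, size i : ℕ) : ℝ) * ((K + 2) * Real.logb 2 V) ≤
        (2 * (K + 2)) ^ 2 * (V * E * Real.logb 2 V) := by
      calc V * ((∑ i, size i : ℕ) : ℝ) * ((K + 2) * Real.logb 2 V)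
          ≤ V * (2 * E) * ((K + 2) * Real.logb 2 V) := by gcongr
        _ = 2 * (K + 2) * (V * E * Real.logb 2 V) := by ring
        _ ≤ (2 * (K + 2)) ^ 2 * (V * E * Real.logb 2 V) := by
            gcongr
            nlinarith
    refine (Real.sqrt_le_sqrt h4).trans (le_of_eq ?_)
    rw [Real.sqrt_mul (by positivity), Real.sqrt_sq (by positivity)]
  nlinarith

end Models

/-! ### What the answers of the black box reveal in each model. -/

theorem AdjMatrix.exists_dest_iff {V : ℕ} (G : AdjMatrix V) (i u : Fin V) :
    G.toDigraph.Adj i u ↔ ∃ x, (if G.entry i x = 1 then some x else none) = some u := by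
  constructor
  · intro h
    exact ⟨u, if_pos h⟩
  · rintro ⟨x, hx⟩
    split_ifs at hx with h
    cases hx
    exact h

theorem AdjMatrix.dest_injective {V : ℕ} (G : AdjMatrix V) (i x y u : Fin V)
    (hx : (if G.entry i x = 1 then some x else none) = some u)
    (hy : (if G.entry i y = 1 then some y else none) = some u) : x = y := by
  split_ifs at hx hy
  cases hx
  cases hy
  rfl

theorem EdgeList.dest_injective {V : ℕ} (G : EdgeList V) (i : Fin V) (x y : Fin (G.deg i))
    (u : Fin V) (hx : some (G.nbr i x) = some u) (hy : some (G.nbr i y) = some u) : x = y :=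
  G.injective i (Option.some_inj.1 (hx.trans hy.symm))

theorem EdgeList.exists_dest_iff {V : ℕ} (G : EdgeList V) (i u : Fin V) :
    G.toDigraph.Adj i u ↔ ∃ x, some (G.nbr i x) = some u := by
  simp [EdgeList.toDigraph]

/-- Guarantees `lg V ≥ 1`; for `V = 1` the asserted time bound would be 0. -/
theorem EdgeList.two_le_of_sum_deg_pos {V : ℕ} (G : EdgeList V) (h : 0 < ∑ i, G.deg i) :
    2 ≤ V := by
  obtain ⟨i, -, hi⟩ := Finset.exists_ne_zero_of_sum_ne_zero h.ne'
  have h1 := G.loopless i ⟨0, Nat.pos_of_ne_zero hi⟩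
  by_contra hV
  have := i.2
  exact h1 (Fin.ext (by omega))

end QuantumBFS

theorem theorem5 (p : Polynomial ℝ) :
    ∃ C : ℝ, 0 < C ∧
      (∀ (V : ℕ) [NeZero V] (G : QuantumBFS.EdgeList V) (E : ℕ) (a : Fin V) (ε : ℝ),
        G.IsEdgeCount E → 0 < ε → ε < 1 → ε⁻¹ ≤ p.eval (V : ℝ) →
          (QuantumBFS.EdgeList.bfs G.deg a ε).failureProb G.nbr
              (QuantumBFS.IsBreadthFirstSearch G.toDigraph a) ≤ ENNReal.ofReal ε ∧
          (0 < E →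
            (QuantumBFS.EdgeList.bfs G.deg a ε).expectedTime G.nbr ≤
              ENNReal.ofReal (C * Real.sqrt (V * E * Real.logb 2 V)))) ∧
      (∀ (V : ℕ) (G : QuantumBFS.AdjMatrix V) (a : Fin V) (ε : ℝ),
        0 < ε → ε < 1 → ε⁻¹ ≤ p.eval (V : ℝ) →
          (QuantumBFS.AdjMatrix.bfs a ε).failureProb G.entry
              (QuantumBFS.IsBreadthFirstSearch G.toDigraph a) ≤ ENNReal.ofReal ε ∧
          (2 ≤ V →
            (QuantumBFS.AdjMatrix.bfs a ε).expectedTime G.entry ≤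
              ENNReal.ofReal (C * Real.sqrt ((V : ℝ) ^ 3 * Real.logb 2 V)))) := by
  obtain ⟨K, hK0, hK⟩ := QuantumBFS.exists_eval_le_rpow p
  refine ⟨971 * (2 * (K + 2)), by positivity, ?_, ?_⟩
  · intro V _ G E a ε hE h0 h1 hp
    refine ⟨QuantumBFS.failureProb_bfs_le (dest := fun _ _ r => some r) (ans := G.nbr)
      G.dest_injective G.exists_dest_iff a h0 h1, fun hE0 => ?_⟩
    have hE1 : E ≤ ∑ i, G.deg i ∧ ∑ i, G.deg i ≤ 2 * E := by
      rcases hE with hE | ⟨-, hE⟩ <;> omega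
    have hV := G.two_le_of_sum_deg_pos (by omega)
    exact QuantumBFS.expectedTime_bfs_le (dest := fun _ _ r => some r) (ans := G.nbr)
      G.dest_injective a h0 h1 hK0 hV hp (hK V hV) hE0 hE1.1 hE1.2
  · intro V G a ε h0 h1 hp
    refine ⟨QuantumBFS.failureProb_bfs_le (dest := fun _ x r => if r = 1 then some x else none)
      (ans := G.entry) G.dest_injective G.exists_dest_iff a h0 h1, fun hV => ?_⟩
    have hS : ∑ _i : Fin V, V = V * V := by simp
    -- Here every domain has size `V`, so `V * V` takes the place of the number of edges.
    have := QuantumBFS.expectedTime_bfs_le (dest := fun _ x r => if r = 1 then some x else none)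
      (ans := G.entry) G.dest_injective a h0 h1 hK0 hV hp (hK V hV) (E := V * V)
      (Nat.mul_pos (by omega) (by omega)) hS.ge (by rw [hS]; omega)
    rw [show ((V : ℝ) ^ 3 * Real.logb 2 V) = V * ((V * V : ℕ) : ℝ) * Real.logb 2 V by
      push_cast; ring]
    exact this
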